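/- **Setting.** Let $\beta>0$, $\gamma\ge 0$ be real. Put $A=\begin{pmatrix}A_{0,0}&A_{0,1}\\A_{1,0}&A_{1,1}\end{pmatrix}=\begin{pmatrix}\beta&1\\1&\gamma\end{pmatrix}$ and, for $\lambda\in\mathbb{C}$, $b_0=1$, $b_1=\lambda$. For a finite simple graph $G=(V,E)$, a set $S\subseteq V$ and $\tau_S\in\{0,1\}^S$, the partition function of the 2-spin system is $$Z^{\beta,\gamma}_{\tau_S}(G,\lambda)=\sum_{\substack{\sigma\in\{0,1\}^V\\ \sigma|_S=\tau_S}}\ \prod_{\{u,v\}\in E}A_{\sigma(u),\sigma(v)}\prod_{v\in V}b_{\sigma(v)} .$$ The configuration $\tau_S$ is *feasible* if no edge $\{u,v\}\subseteq S$ has $\tau_S(u)=\tau_S(v)=0$ in case $\beta=0$, and none has $\tau_S(u)=\tau_S(v)=1$ in case $\gamma=0$. For $U\subseteq\mathbb{C}$ and $\delta>0$ let $\mathcal{U}(U,\delta)=\{z\in\mathbb{C}:\exists z'\in U,\ |z-z'|<\delta\}$. For real $\lambda_0$, $[0,\lambda_0]$ denotes the real segment between $0$ and $\lambda_0$ (also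 when $\lambda_0<0$). If $\beta\gamma<1$, put $\bar d=\frac{1+\sqrt{\beta\gamma}}{1-\sqrt{\beta\gamma}}$ and, for real $d\ge\bar d$ (with $d>1$ if $\gamma=0$), $$\hat x_d=\begin{cases}\dfrac{-1-\beta\gamma+d(1-\beta\gamma)-\sqrt{(-1-\beta\gamma+d(1-\beta\gamma))^2-4\beta\gamma}}{2\gamma},&\gamma>0,\\[2mm] \dfrac{\beta}{d-1},&\gamma=0,\end{cases}\qquad \lambda_c(d)=\hat x_d\left(\frac{\hat x_d+\beta}{\gamma\hat x_d+1}\right)^{d}.$$ If moreover $\beta>1$, let $d_c$ be the unique real number in $(\bar d,\infty)$ such that $\lambda_c$ is strictly decreasing on $(\bar d,d_c)$ and strictly increasing on $(d_c,\infty)$. **Theorem.** Let $\beta>0$, $\gamma\ge 0$ and $\lambda_0\ne 0$ be real numbers satisfying one of the following conditions: 1. $\beta\gamma>1$, $\gamma\le 1$ and $-1<\lambda_0<\left(\frac{\beta}{\gamma}\right)^{\frac{\sqrt{\beta\gamma}}{\sqrt{\beta\gamma}-1}}$; 2. $\beta\gamma<1$, $\beta>1$ and $\max\left\{-1,-\frac{\beta-1}{1-\gamma}\right\}<\lambda_0<\lambda_c(d_c)$.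 Then there exists $\delta>0$, depending only on $\beta,\gamma,\lambda_0$, such that $Z^{\beta,\gamma}_{\tau_S}(G,\lambda)\neq 0$ for every $\lambda\in\mathcal{U}([0,\lambda_0],\delta)$ with $\lambda\ne 0$, every finite simple graph $G=(V,E)$ (with no bound on its degrees), every $S\subseteq V$ and every feasible configuration $\tau_S$. -/

import Mathlib

/-- The edge interaction matrix `[[β, 1], [1, γ]]`, indexed by spins `0, 1`. -/
def TwoSpin.edgeMatrix (β γ : ℝ) : Matrix (Fin 2) (Fin 2) ℂ :=
  !![(β : ℂ), 1; 1, (γ : ℂ)]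

theorem TwoSpin.edgeMatrix_comm (β γ : ℝ) (i j : Fin 2) :
    TwoSpin.edgeMatrix β γ i j = TwoSpin.edgeMatrix β γ j i := by
  fin_cases i <;> fin_cases j <;> rfl

/-- The vertex weights `b₀ = 1`, `b₁ = lam`. -/
def TwoSpin.vertexWeight (lam : ℂ) : Fin 2 → ℂ := ![1, lam]

/-- The weight `A (σ u) (σ v)` of an (unordered) edge `{u, v}` under the configuration `σ`. -/
def TwoSpin.edgeWeight {V : Type*} (β γ : ℝ) (σ : V → Fin 2) : Sym2 V → ℂ :=
  Sym2.lift ⟨fun u v => TwoSpin.edgeMatrix β γ (σ u) (σ v),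
    fun u v => TwoSpin.edgeMatrix_comm β γ (σ u) (σ v)⟩

open Classical in
/-- The partition function of the 2-spin system on the finite graph `G`, the spins of the
vertices in `S` being pinned by `τ`: the sum over all configurations extending `τ` of the product
of all edge weights and all vertex weights (those of pinned vertices included). -/
noncomputable def TwoSpin.partitionFunction {V : Type*} [Fintype V] (β γ : ℝ)
    (G : SimpleGraph V) (S : Set V) (τ : S → Fin 2) (lam : ℂ) : ℂ :=
  ∑ σ : V → Fin 2 with ∀ v : S, σ v = τ v,
    (∏ e ∈ G.edgeFinset, TwoSpin.edgeWeight β γ σ e) * ∏ v : V, TwoSpin.vertexWeight lam (σ v)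

/-- Feasible partial configurations: no edge inside `S` has both ends pinned to `0` if `β = 0`,
and none has both ends pinned to `1` if `γ = 0`. -/
def TwoSpin.Feasible {V : Type*} (β γ : ℝ) (G : SimpleGraph V) (S : Set V) (τ : S → Fin 2) :
    Prop :=
  (β = 0 → ∀ u v : S, G.Adj u v → ¬ (τ u = 0 ∧ τ v = 0)) ∧
  (γ = 0 → ∀ u v : S, G.Adj u v → ¬ (τ u = 1 ∧ τ v = 1))

/-- `d̄ = (1 + √(βγ)) / (1 - √(βγ))`. -/
noncomputable def TwoSpin.dBar (β γ : ℝ) : ℝ :=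
  (1 + √(β * γ)) / (1 - √(β * γ))

/-- `x̂_d`, for a real number `d ≥ d̄`. -/
noncomputable def TwoSpin.xHat (β γ d : ℝ) : ℝ :=
  if γ = 0 then β / (d - 1)
  else (-1 - β * γ + d * (1 - β * γ)
    - √((-1 - β * γ + d * (1 - β * γ)) ^ 2 - 4 * (β * γ))) / (2 * γ)

/-- `λ_c(d) = x̂_d ((x̂_d + β) / (γ x̂_d + 1)) ^ d`, for a real number `d ≥ d̄`. -/
noncomputable def TwoSpin.lamC (β γ d : ℝ) : ℝ :=
  TwoSpin.xHat β γ d * ((TwoSpin.xHat β γ d + β) / (γ * TwoSpin.xHat β γ d + 1)) ^ d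

/-- `d` is the turning point of `λ_c`: it lies in `(d̄, ∞)`, and `λ_c` is strictly decreasing on
`(d̄, d)` and strictly increasing on `(d, ∞)`. -/
def TwoSpin.IsTurningPoint (β γ d : ℝ) : Prop :=
  TwoSpin.dBar β γ < d ∧
  StrictAntiOn (TwoSpin.lamC β γ) (Set.Ioo (TwoSpin.dBar β γ) d) ∧
  StrictMonoOn (TwoSpin.lamC β γ) (Set.Ioi d)

/-- There is at most one turning point. -/
theorem TwoSpin.IsTurningPoint.unique {β γ d d' : ℝ} (h : TwoSpin.IsTurningPoint β γ d)
    (h' : TwoSpin.IsTurningPoint β γ d') : d = d' := by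
  have key : ∀ a b : ℝ, TwoSpin.IsTurningPoint β γ a → TwoSpin.IsTurningPoint β γ b →
      ¬ a < b := by
    intro a b ha hb hab
    obtain ⟨x, hx1, hx2⟩ := exists_between hab
    obtain ⟨y, hy1, hy2⟩ := exists_between hx2
    have h1 := ha.2.2 (Set.mem_Ioi.2 hx1) (Set.mem_Ioi.2 (hx1.trans hy1)) hy1
    have h2 := hb.2.1 ⟨ha.1.trans hx1, hx2⟩ ⟨ha.1.trans (hx1.trans hy1), hy2⟩ hy1
    exact lt_asymm h1 h2
  exact le_antisymm (not_lt.1 (key _ _ h' h)) (not_lt.1 (key _ _ h h'))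

/-- `d_c`: the turning point of `λ_c` (used for `β > 1`, `γ ≥ 0`, `βγ < 1`). -/
noncomputable def TwoSpin.dC (β γ : ℝ) : ℝ :=
  Classical.epsilon (TwoSpin.IsTurningPoint β γ)

/-! The ratio of the weights of spin 1 and spin 0 at a vertex is its activity times a product over
its neighbours of factors (1 + γx)/(β + x), where x is a ratio in a smaller system with modified
activities. Pinned neighbours contribute factors β⁻¹ or γ. So it suffices to find a multiplicative
monoid M containing β⁻¹ and γ, mapped to itself by m ↦ (1 + γλm)/(β + λm), with 1 + λm and β + λm
nonzero on M (`spinSum_ne_zero`, `partitionFunction_ne_zero`). Closure under products is what makes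
the degree irrelevant.

Such an M is `coneMonoid`: the numbers exp(-S) with S in a thin cone around [0, ∞), and 0. With g(x)
= log((β + x)/(1 + γx)), the recursion reads S ↦ g(λ exp(-S)). A deviation εR at S = R is multiplied
to first order by |x g'(x)|, x = λ exp(-R), so the cone is preserved if R |x g'(x)| < g(x). For λ on
[0, λ₀] this follows from one real inequality over s in [0, 1], with x = λ₀s. Compactness gives a
uniform gap, which absorbs complex perturbations (`exists_zeroFree_of_contraction`).

For λ₀ < 0 elementary logarithm bounds prove the real inequality. For λ₀ > 0 it follows from log λ₀
lying below `logCriticalActivity` on (0, ∞). The minimum of that function gives the stated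
threshold: explicitly if βγ > 1, and through the change of variable between the degree d and the
fixed point x if βγ < 1. -/

namespace TwoSpin

open Finset

/-! ### Partition functions and the ratio recursion -/

section Combinatorics

variable {V : Type*}

open Classical in
/-- The number of edges of `G` with both ends in `B`. -/
noncomputable def innerEdges [Fintype V] (G : SimpleGraph V) (B : Finset V) : ℕ :=
  #{e ∈ G.edgeFinset | ∀ v ∈ e, v ∈ B}

open Classical in
/-- The neighbours of `v` in `B`. -/
noncomputable def nbrsIn (G : SimpleGraph V) (B : Finset V) (v : V) : Finset V :=
  {u ∈ B | G.Adj v u}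

theorem mem_nbrsIn {G : SimpleGraph V} {B : Finset V} {u v : V} :
    u ∈ nbrsIn G B v ↔ u ∈ B ∧ G.Adj v u := by
  simp [nbrsIn]

open Classical in
theorem innerEdges_insert [Fintype V] (G : SimpleGraph V) {B : Finset V} {v : V} (hv : v ∉ B) :
    innerEdges G (insert v B) = innerEdges G B + #(nbrsIn G B v) := by
  have hset : (G.edgeFinset.filter fun e => ∀ u ∈ e, u ∈ insert v B) =
      (G.edgeFinset.filter fun e => ∀ u ∈ e, u ∈ B) ∪
        (nbrsIn G B v).image (fun u => s(v, u)) := by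
    ext e
    induction e using Sym2.ind with
    | _ x y =>
      simp only [mem_filter, SimpleGraph.mem_edgeFinset, SimpleGraph.mem_edgeSet, Sym2.mem_iff,
        forall_eq_or_imp, forall_eq, mem_insert, mem_union, mem_image, mem_nbrsIn, Sym2.eq_iff]
      constructor
      · rintro ⟨h, rfl | hx, rfl | hy⟩
        · exact absurd h (G.loopless.irrefl _)
        · exact Or.inr ⟨y, ⟨hy, h⟩, Or.inl ⟨rfl, rfl⟩⟩
        · exact Or.inr ⟨x, ⟨hx, h.symm⟩, Or.inr ⟨rfl, rfl⟩⟩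
        · exact Or.inl ⟨h, hx, hy⟩
      · rintro (⟨h, hx, hy⟩ | ⟨u, ⟨hu, h⟩, ⟨rfl, rfl⟩ | ⟨rfl, rfl⟩⟩)
        · exact ⟨h, Or.inr hx, Or.inr hy⟩
        · exact ⟨h, Or.inl rfl, Or.inr hu⟩
        · exact ⟨h.symm, Or.inr hu, Or.inl rfl⟩
  have hdisj : Disjoint (G.edgeFinset.filter fun e => ∀ u ∈ e, u ∈ B)
      ((nbrsIn G B v).image (fun u => s(v, u))) := by
    rw [Finset.disjoint_left]
    intro e he he'
    obtain ⟨u, -, rfl⟩ := mem_image.1 he'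
    exact hv ((mem_filter.1 he).2 v (by simp))
  unfold innerEdges
  rw [hset, card_union_of_disjoint hdisj, card_image_of_injective]
  exact fun a b hab => Sym2.congr_right.1 hab

open Classical in
theorem card_nbrsIn_union (G : SimpleGraph V) {A B : Finset V} (h : Disjoint A B) (v : V) :
    #(nbrsIn G (A ∪ B) v) = #(nbrsIn G A v) + #(nbrsIn G B v) := by
  unfold nbrsIn
  rw [filter_union, card_union_of_disjoint (disjoint_filter_filter h)]

open Classical in
theorem innerEdges_union [Fintype V] (G : SimpleGraph V) {A B : Finset V} (h : Disjoint A B) :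
    innerEdges G (A ∪ B) = innerEdges G A + innerEdges G B + ∑ v ∈ A, #(nbrsIn G B v) := by
  induction A using Finset.induction_on with
  | empty => simp [innerEdges, filter_eq_empty_iff, Sym2.forall]
  | insert v A hv ih =>
    rw [disjoint_insert_left] at h
    rw [insert_union, innerEdges_insert G (by simp [hv, h.1]), ih h.2, innerEdges_insert G hv,
      card_nbrsIn_union G h.2, sum_insert hv]
    ring

open Classical in
/-- The partition function of the subgraph induced on `T`, with activity `w v` at `v`, as a sum
over the sets of vertices of spin `1`. -/
noncomputable def spinSum [Fintype V] (G : SimpleGraph V) (β γ : ℂ) (T : Finset V)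
    (w : V → ℂ) : ℂ :=
  ∑ A ∈ T.powerset, β ^ innerEdges G (T \ A) * γ ^ innerEdges G A * ∏ v ∈ A, w v

open Classical in
/-- The activities `w`, multiplied by `c` on `Q`. -/
noncomputable def scaleOn (c : ℂ) (Q : Finset V) (w : V → ℂ) (u : V) : ℂ :=
  if u ∈ Q then c * w u else w u

theorem scaleOn_empty (c : ℂ) (w : V → ℂ) : scaleOn c ∅ w = w := by
  funext u; simp [scaleOn]

open Classical in
theorem prod_scaleOn (c : ℂ) (Q A : Finset V) (w : V → ℂ) :
    ∏ u ∈ A, scaleOn c Q w u = c ^ #(A ∩ Q) * ∏ u ∈ A, w u := by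
  have : ∀ u, scaleOn c Q w u = (if u ∈ Q then c else 1) * w u := fun u => by
    unfold scaleOn; split_ifs <;> simp
  simp_rw [this]
  rw [prod_mul_distrib, prod_ite, prod_const_one, mul_one, prod_const, filter_mem_eq_inter]

theorem spinSum_congr [Fintype V] (G : SimpleGraph V) (β γ : ℂ) {T : Finset V} {w w' : V → ℂ}
    (h : ∀ u ∈ T, w u = w' u) : spinSum G β γ T w = spinSum G β γ T w' := by
  unfold spinSum
  refine sum_congr rfl fun A hA => ?_
  rw [prod_congr rfl fun u hu => h u (mem_powerset.1 hA hu)]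

open Classical in
-- Condition on the spin of `v`. For spin 0, charge β for every neighbour in `T` and correct by β⁻¹
-- at those of spin 1; for spin 1, each neighbour of spin 1 costs γ.
theorem spinSum_insert [Fintype V] (G : SimpleGraph V) {β : ℂ} (hβ : β ≠ 0) (γ : ℂ) {T : Finset V}
    {v : V} (hv : v ∉ T) (w : V → ℂ) :
    spinSum G β γ (insert v T) w =
      β ^ #(nbrsIn G T v) * spinSum G β γ T (scaleOn β⁻¹ (nbrsIn G T v) w) +
        w v * spinSum G β γ T (scaleOn γ (nbrsIn G T v) w) := by
  unfold spinSum
  rw [sum_powerset_insert hv, mul_sum, mul_sum]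
  congr 1
  · refine sum_congr rfl fun A hA => ?_
    have hAT := mem_powerset.1 hA
    have hvA : v ∉ A := fun h => hv (hAT h)
    have hd : Disjoint (T \ A) A := sdiff_disjoint
    have hcard : #(nbrsIn G T v) = #(nbrsIn G (T \ A) v) + #(nbrsIn G A v) := by
      rw [← card_nbrsIn_union G hd, sdiff_union_of_subset hAT]
    have hint : A ∩ nbrsIn G T v = nbrsIn G A v := by
      ext u
      simp only [mem_inter, mem_nbrsIn]
      exact ⟨fun h => ⟨h.1, h.2.2⟩, fun h => ⟨h.1, hAT h.1, h.2⟩⟩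
    rw [insert_sdiff_of_notMem _ hvA, innerEdges_insert G (by simp [hv]), prod_scaleOn, hint,
      hcard, pow_add, pow_add, inv_pow]
    field_simp
  · refine sum_congr rfl fun A hA => ?_
    have hAT := mem_powerset.1 hA
    have hvA : v ∉ A := fun h => hv (hAT h)
    have hint : A ∩ nbrsIn G T v = nbrsIn G A v := by
      ext u
      simp only [mem_inter, mem_nbrsIn]
      exact ⟨fun h => ⟨h.1, h.2.2⟩, fun h => ⟨h.1, hAT h.1, h.2⟩⟩
    have hs : insert v T \ insert v A = T \ A := by
      rw [insert_sdiff_insert]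
      ext u; simp only [mem_sdiff, mem_insert, not_or]
      exact ⟨fun h => ⟨h.1, h.2.2⟩, fun h => ⟨h.1, fun e => hv (e ▸ h.1), h.2⟩⟩
    rw [hs, innerEdges_insert G hvA, prod_scaleOn, hint, prod_insert hvA, pow_add]
    ring

/-- Zero-freeness from a multiplicative monoid of ratios that is stable under the recursion. -/
theorem spinSum_ne_zero [Fintype V] (G : SimpleGraph V) {β : ℂ} (hβ : β ≠ 0) {γ lam : ℂ}
    (M : Submonoid ℂ) (hβM : β⁻¹ ∈ M) (hγM : γ ∈ M) (h1 : ∀ m ∈ M, 1 + lam * m ≠ 0)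
    (h2 : ∀ m ∈ M, β + lam * m ≠ 0)
    (h3 : ∀ m ∈ M, (1 + γ * (lam * m)) / (β + lam * m) ∈ M) (T : Finset V) :
    ∀ w : V → ℂ, (∀ u ∈ T, ∃ m ∈ M, w u = lam * m) →
      spinSum G β γ T w ≠ 0 ∧ ∀ Q ⊆ T, ∃ m ∈ M, spinSum G β γ T (scaleOn γ Q w) =
        m * (β ^ #Q * spinSum G β γ T (scaleOn β⁻¹ Q w)) := by
  classical
  have hscale : ∀ {T : Finset V} {w : V → ℂ} {c : ℂ} (Q : Finset V), c ∈ M →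
      (∀ u ∈ T, ∃ m ∈ M, w u = lam * m) → ∀ u ∈ T, ∃ m ∈ M, scaleOn c Q w u = lam * m := by
    intro T w c Q hc hw u hu
    obtain ⟨m, hm, e⟩ := hw u hu
    unfold scaleOn
    split_ifs
    · exact ⟨c * m, M.mul_mem hc hm, by rw [e]; ring⟩
    · exact ⟨m, hm, e⟩
  induction h : #T using Nat.strong_induction_on generalizing T with
  | _ n ih =>
    -- The sum is affine in the activity at `q`. The ratio of its two coefficients is the ratio
    -- statement for `T.erase q`, with the neighbours of `q` as the scaled set.
    have hvert : ∀ q ∈ T, ∀ w : V → ℂ, (∀ u ∈ T, ∃ m ∈ M, w u = lam * m) →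
        ∃ D N : ℂ, D ≠ 0 ∧ (∃ m ∈ M, N = m * D) ∧
          ∀ t, spinSum G β γ T (Function.update w q t) = D + t * N := by
      intro q hq w hw
      have hqn : q ∉ T.erase q := notMem_erase q T
      have hw' : ∀ u ∈ T.erase q, ∃ m ∈ M, w u = lam * m := fun u hu =>
        hw u (mem_of_mem_erase hu)
      have hlt : #(T.erase q) < n := h ▸ card_erase_lt_of_mem hq
      have hsub : nbrsIn G (T.erase q) q ⊆ T.erase q := fun u hu => (mem_nbrsIn.1 hu).1
      refine ⟨_, _, mul_ne_zero (pow_ne_zero _ hβ)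
        (ih _ hlt (T.erase q) rfl _ (hscale (nbrsIn G (T.erase q) q) hβM hw')).1,
        (ih _ hlt (T.erase q) rfl _ hw').2 _ hsub, fun t => ?_⟩
      conv_lhs => rw [← insert_erase hq]
      rw [spinSum_insert G hβ γ hqn, Function.update_self]
      have hc : ∀ c, spinSum G β γ (T.erase q)
          (scaleOn c (nbrsIn G (T.erase q) q) (Function.update w q t)) =
          spinSum G β γ (T.erase q) (scaleOn c (nbrsIn G (T.erase q) q) w) := fun c => by
        refine spinSum_congr G β γ fun u hu => ?_
        have : u ≠ q := ne_of_mem_erase hu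
        simp [scaleOn, this]
      rw [hc, hc]
    have hne : ∀ w : V → ℂ, (∀ u ∈ T, ∃ m ∈ M, w u = lam * m) → spinSum G β γ T w ≠ 0 := by
      intro w hw
      rcases T.eq_empty_or_nonempty with rfl | ⟨q, hq⟩
      · simp [spinSum, innerEdges, filter_eq_empty_iff, Sym2.forall]
      · obtain ⟨D, N, hD, ⟨m, hm, rfl⟩, hN⟩ := hvert q hq w hw
        obtain ⟨m', hm', e⟩ := hw q hq
        have := hN (w q)
        rw [Function.update_eq_self] at this
        rw [this, e, show D + lam * m' * (m * D) = D * (1 + lam * (m' * m)) by ring]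
        exact mul_ne_zero hD (h1 _ (M.mul_mem hm' hm))
    intro w hw
    refine ⟨hne w hw, fun Q => ?_⟩
    -- Telescoping: the vertices of `Q` pass from the factor β⁻¹ to γ one at a time, each step
    -- contributing one factor of the form in `h3`.
    induction Q using Finset.induction_on generalizing w with
    | empty => exact fun _ => ⟨1, M.one_mem, by simp [scaleOn_empty]⟩
    | insert q Q hqQ ihQ =>
      intro hQT
      have hq : q ∈ T := hQT (mem_insert_self q Q)
      have hQ : Q ⊆ T := fun u hu => hQT (mem_insert_of_mem hu)
      obtain ⟨m₀, hm₀, e₀⟩ := hw q hq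
      -- The intermediate term has γ on `Q` and β⁻¹ at `q`; the remaining change at `q` is read off
      -- from the affine form.
      obtain ⟨m, hm, e⟩ := ihQ (scaleOn β⁻¹ {q} w) (hscale _ hβM hw) hQ
      obtain ⟨D, N, hD, ⟨m', hm', rfl⟩, hN⟩ := hvert q hq _ (hscale Q hγM hw)
      have s1 : scaleOn γ (insert q Q) w = Function.update (scaleOn γ Q w) q (γ * w q) := by
        funext u
        by_cases hu : u = q
        · subst hu; simp [scaleOn]
        · simp [scaleOn, hu]
      have s2 : scaleOn γ Q (scaleOn β⁻¹ {q} w) =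
          Function.update (scaleOn γ Q w) q (β⁻¹ * w q) := by
        funext u
        by_cases hu : u = q
        · subst hu; simp [scaleOn, hqQ]
        · simp [scaleOn, hu]
      have s3 : scaleOn β⁻¹ Q (scaleOn β⁻¹ {q} w) = scaleOn β⁻¹ (insert q Q) w := by
        funext u
        by_cases hu : u = q
        · subst hu; simp [scaleOn, hqQ]
        · simp [scaleOn, hu]
      rw [s2, hN, s3] at e
      have hmm := M.mul_mem hm₀ hm'
      refine ⟨(1 + γ * (lam * (m₀ * m'))) / (β + lam * (m₀ * m')) * m,
        M.mul_mem (h3 _ hmm) hm, ?_⟩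
      rw [s1, hN, card_insert_of_notMem hqQ, pow_succ]
      have h2' := h2 _ hmm
      have e' : D * (β + lam * (m₀ * m')) =
          β * (m * (β ^ #Q * spinSum G β γ T (scaleOn β⁻¹ (insert q Q) w))) := by
        rw [← e, e₀]; field_simp
      rw [e₀, div_mul_eq_mul_div, div_mul_eq_mul_div, eq_div_iff h2']
      linear_combination (1 + γ * (lam * (m₀ * m'))) * e'

open Classical in
theorem configWeight_eq [Fintype V] (G : SimpleGraph V) (β γ : ℝ) (lam : ℂ) (σ : V → Fin 2) :
    (∏ e ∈ G.edgeFinset, edgeWeight β γ σ e) * ∏ v : V, vertexWeight lam (σ v) =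
      (β : ℂ) ^ innerEdges G {v | σ v = 0} * (γ : ℂ) ^ innerEdges G {v | σ v = 1} *
        lam ^ #{v | σ v = 1} := by
  have hspin : ∀ i : Fin 2, i = 0 ∨ i = 1 := by decide
  have he : ∀ e, edgeWeight β γ σ e = (if ∀ v ∈ e, v ∈ ({v | σ v = 0} : Finset V) then (β : ℂ)
      else 1) * (if ∀ v ∈ e, v ∈ ({v | σ v = 1} : Finset V) then (γ : ℂ) else 1) := by
    intro e
    induction e using Sym2.ind with
    | _ x y =>
      rcases hspin (σ x) with hx | hx <;> rcases hspin (σ y) with hy | hy <;>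
        simp [edgeWeight, edgeMatrix, hx, hy]
  have hv : ∀ v, vertexWeight lam (σ v) = if σ v = 1 then lam else 1 := by
    intro v
    rcases hspin (σ v) with h | h <;> simp [vertexWeight, h]
  simp_rw [he, hv]
  rw [prod_mul_distrib, prod_ite, prod_ite, prod_ite]
  simp only [prod_const_one, mul_one, prod_const, innerEdges]

open Classical in
-- Pinned vertices are absorbed into the activities of their free neighbours. The prefactor treats
-- every free vertex as having spin 0 towards `A₀`, which β⁻¹ undoes at free vertices of spin 1.
theorem partitionFunction_eq_spinSum [Fintype V] (G : SimpleGraph V) {β : ℝ} (hβ : β ≠ 0) (γ : ℝ)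
    (S : Set V) (τ : S → Fin 2) (lam : ℂ) :
    ∃ (A₀ A₁ : Finset V) (n : ℕ), (∀ u, u ∈ A₁ ↔ ∃ h : u ∈ S, τ ⟨u, h⟩ = 1) ∧
      partitionFunction β γ G S τ lam =
        (β : ℂ) ^ n * (γ : ℂ) ^ innerEdges G A₁ * lam ^ #A₁ *
          spinSum G β γ {u | u ∉ S}
            (fun u => lam * ((β : ℂ)⁻¹ ^ #(nbrsIn G A₀ u) * (γ : ℂ) ^ #(nbrsIn G A₁ u))) := by
  have hspin : ∀ i : Fin 2, i = 0 ∨ i = 1 := by decide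
  have hβ' : (β : ℂ) ≠ 0 := by exact_mod_cast hβ
  set A₀ : Finset V := {u | ∃ h : u ∈ S, τ ⟨u, h⟩ = 0} with hA₀
  set A₁ : Finset V := {u | ∃ h : u ∈ S, τ ⟨u, h⟩ = 1} with hA₁
  set T : Finset V := {u | u ∉ S} with hT
  refine ⟨A₀, A₁, innerEdges G A₀ + ∑ v ∈ T, #(nbrsIn G A₀ v), fun u => by simp [hA₁], ?_⟩
  unfold partitionFunction spinSum
  rw [mul_sum]
  simp_rw [configWeight_eq]
  refine sum_bij' (fun σ _ => {u ∈ T | σ u = 1}) (fun A _ u => if u ∈ A ∪ A₁ then 1 else 0)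
    ?_ ?_ ?_ ?_ ?_
  · intro σ _
    simp
  · intro A hA
    have hA' := mem_powerset.1 hA
    simp only [mem_filter, mem_univ, true_and]
    rintro ⟨v, hv⟩
    have hvA : v ∉ A := fun h => by simpa [hT, hv] using hA' h
    rcases hspin (τ ⟨v, hv⟩) with h | h <;> simp [hvA, hA₁, hv, h]
  · intro σ hσ
    simp only [mem_filter, mem_univ, true_and] at hσ
    funext u
    by_cases hu : u ∈ S
    · have := hσ ⟨u, hu⟩
      rcases hspin (τ ⟨u, hu⟩) with h | h <;> simp [hT, hA₁, hu, h] <;> simpa [h] using this.symm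
    · rcases hspin (σ u) with h | h <;> simp [hT, hA₁, hu, h]
  · intro A hA
    have hA' := mem_powerset.1 hA
    ext u
    simp only [mem_filter]
    constructor
    · rintro ⟨hu, h⟩
      by_contra huA
      have : u ∉ S := by simpa [hT] using hu
      simp [huA, hA₁, this] at h
    · intro hu
      exact ⟨hA' hu, by simp [hu]⟩
  · intro σ hσ
    simp only [mem_filter, mem_univ, true_and] at hσ
    set A : Finset V := {u ∈ T | σ u = 1} with hA
    have hAT : A ⊆ T := filter_subset _ _
    have e1 : ({v | σ v = 1} : Finset V) = A ∪ A₁ := by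
      ext u
      by_cases hu : u ∈ S
      · have := hσ ⟨u, hu⟩
        simp [hA, hT, hA₁, hu, ← this]
      · simp [hA, hT, hA₁, hu]
    have e0 : ({v | σ v = 0} : Finset V) = (T \ A) ∪ A₀ := by
      ext u
      by_cases hu : u ∈ S
      · have := hσ ⟨u, hu⟩
        simp [hA, hT, hA₀, hu, ← this]
      · rcases hspin (σ u) with h | h <;> simp [hA, hT, hA₀, hu, h]
    have hd1 : Disjoint T A₁ := by
      rw [Finset.disjoint_left]; intro u hu hu'
      obtain ⟨h, -⟩ := (mem_filter.1 hu').2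
      exact (mem_filter.1 hu).2 h
    have hd0 : Disjoint T A₀ := by
      rw [Finset.disjoint_left]; intro u hu hu'
      obtain ⟨h, -⟩ := (mem_filter.1 hu').2
      exact (mem_filter.1 hu).2 h
    have hd1' : Disjoint A A₁ := disjoint_of_subset_left hAT hd1
    rw [e0, e1, innerEdges_union G (disjoint_of_subset_left sdiff_subset hd0),
      innerEdges_union G hd1', card_union_of_disjoint hd1',
      ← sum_sdiff hAT]
    have hp : ∏ u ∈ A, lam * ((β : ℂ)⁻¹ ^ #(nbrsIn G A₀ u) * (γ : ℂ) ^ #(nbrsIn G A₁ u)) =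
        lam ^ #A * (((β : ℂ) ^ ∑ u ∈ A, #(nbrsIn G A₀ u))⁻¹ *
          (γ : ℂ) ^ ∑ u ∈ A, #(nbrsIn G A₁ u)) := by
      rw [prod_mul_distrib, prod_mul_distrib, prod_pow_eq_pow_sum, prod_pow_eq_pow_sum,
        prod_const, inv_pow]
    rw [hp]
    have hne : (β : ℂ) ^ ∑ u ∈ A, #(nbrsIn G A₀ u) ≠ 0 := pow_ne_zero _ hβ'
    have hc := mul_inv_cancel₀ hne
    simp only [pow_add]
    generalize ((β : ℂ) ^ ∑ u ∈ A, #(nbrsIn G A₀ u)) = x at hc ⊢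
    generalize x⁻¹ = y at hc ⊢
    generalize (β : ℂ) ^ innerEdges G (T \ A) = a1
    generalize (β : ℂ) ^ innerEdges G A₀ = a2
    generalize ((β : ℂ) ^ ∑ u ∈ T \ A, #(nbrsIn G A₀ u)) = a3
    generalize (γ : ℂ) ^ innerEdges G A = c1
    generalize (γ : ℂ) ^ innerEdges G A₁ = c2
    generalize ((γ : ℂ) ^ ∑ u ∈ A, #(nbrsIn G A₁ u)) = c3
    generalize lam ^ #A = l1
    generalize lam ^ #A₁ = l2
    linear_combination (-(a1 * a2 * a3 * c1 * c2 * c3 * l1 * l2)) * hc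

end Combinatorics

open Classical in
theorem partitionFunction_ne_zero {V : Type*} [Fintype V] (G : SimpleGraph V) {β γ : ℝ}
    (hβ : β ≠ 0) {lam : ℂ} (hlam : lam ≠ 0) (M : Submonoid ℂ) (hβM : (β : ℂ)⁻¹ ∈ M)
    (hγM : (γ : ℂ) ∈ M) (h1 : ∀ m ∈ M, 1 + lam * m ≠ 0) (h2 : ∀ m ∈ M, (β : ℂ) + lam * m ≠ 0)
    (h3 : ∀ m ∈ M, (1 + (γ : ℂ) * (lam * m)) / (β + lam * m) ∈ M) (S : Set V) (τ : S → Fin 2)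
    (hτ : Feasible β γ G S τ) : partitionFunction β γ G S τ lam ≠ 0 := by
  have hβ' : (β : ℂ) ≠ 0 := by exact_mod_cast hβ
  obtain ⟨A₀, A₁, n, hA₁, h⟩ := partitionFunction_eq_spinSum G hβ γ S τ lam
  rw [h]
  refine mul_ne_zero (mul_ne_zero (mul_ne_zero (pow_ne_zero _ hβ') ?_) (pow_ne_zero _ hlam))
    (spinSum_ne_zero G hβ' M hβM hγM h1 h2 h3 _ _ fun u _ =>
      ⟨_, M.mul_mem (pow_mem hβM _) (pow_mem hγM _), rfl⟩).1
  -- Feasibility enters only here: for γ = 0 it forbids edges inside `A₁`, so the prefactor is 0 ^ 0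
  -- = 1.
  by_cases hγ : γ = 0
  · have : innerEdges G A₁ = 0 := by
      rw [innerEdges, card_eq_zero, filter_eq_empty_iff]
      intro e he hmem
      induction e using Sym2.ind with
      | _ x y =>
        obtain ⟨hx, hx'⟩ := (hA₁ x).1 (hmem x (by simp))
        obtain ⟨hy, hy'⟩ := (hA₁ y).1 (hmem y (by simp))
        exact hτ.2 hγ ⟨x, hx⟩ ⟨y, hy⟩ (by simpa using he) ⟨hx', hy'⟩
    simp [this]
  · exact pow_ne_zero _ (by exact_mod_cast hγ)

/-! ### The cone of logarithmic ratios -/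

/-- The multiplicative monoid consisting of `0` and of the numbers `exp (-S)` with `S` in a
narrow cone around the half-line of the nonnegative real numbers. -/
def coneMonoid (ε : ℝ) : Submonoid ℂ where
  carrier := {z | z = 0 ∨ ∃ (S : ℂ) (R : ℝ), 0 ≤ R ∧ ‖S - R‖ ≤ ε * R ∧ z = Complex.exp (-S)}
  one_mem' := Or.inr ⟨0, 0, le_rfl, by simp, by simp⟩
  mul_mem' := by
    rintro a b (rfl | ⟨S, R, hR, hS, rfl⟩) hb
    · exact Or.inl (zero_mul _)
    rcases hb with rfl | ⟨S', R', hR', hS', rfl⟩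
    · exact Or.inl (mul_zero _)
    refine Or.inr ⟨S + S', R + R', add_nonneg hR hR', ?_, by rw [← Complex.exp_add, neg_add]⟩
    calc ‖S + S' - ((R + R' : ℝ) : ℂ)‖ = ‖(S - R) + (S' - R')‖ := by push_cast; ring_nf
      _ ≤ ε * R + ε * R' := (norm_add_le _ _).trans (add_le_add hS hS')
      _ = ε * (R + R') := by ring

theorem ofReal_mem_coneMonoid {ε : ℝ} (hε : 0 ≤ ε) {x : ℝ} (h0 : 0 ≤ x) (h1 : x ≤ 1) :
    (x : ℂ) ∈ coneMonoid ε := by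
  rcases h0.eq_or_lt with rfl | h0
  · exact Or.inl (by simp)
  · have hl := Real.log_nonpos h0.le h1
    refine Or.inr ⟨((-Real.log x : ℝ) : ℂ), -Real.log x, by linarith, ?_, ?_⟩
    · rw [sub_self, norm_zero]; exact mul_nonneg hε (by linarith)
    · rw [← Complex.ofReal_neg, neg_neg, ← Complex.ofReal_exp, Real.exp_log h0]

/-! ### The recursion in logarithmic coordinates on a half-plane -/

/-- The function `-log ((1 + γ x) / (β + x))`. -/
noncomputable def negLogRatio (β γ : ℝ) (x : ℂ) : ℂ :=
  Complex.log (β + x) - Complex.log (1 + γ * x)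

/-- The derivative of `negLogRatio`. -/
noncomputable def negLogRatioDeriv (β γ : ℝ) (x : ℂ) : ℂ := (β + x)⁻¹ - γ * (1 + γ * x)⁻¹

section HalfPlane

variable {β γ κ : ℝ} {x y : ℂ}

/-- With its companion for β + x and κ < 1, this keeps both arguments of the logarithm in the right
half-plane, at a fixed distance from 0. -/
theorem one_sub_le_re_one_add (hγ0 : 0 ≤ γ) (hγ1 : γ ≤ 1) (hκ0 : 0 ≤ κ) (hx : -κ < x.re) :
    1 - κ ≤ (1 + γ * x).re := by
  simp only [Complex.add_re, Complex.one_re, Complex.mul_re, Complex.ofReal_re, Complex.ofReal_im,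
    zero_mul, sub_zero]
  nlinarith

theorem one_sub_le_re_add (hβ : 1 ≤ β) (hx : -κ < x.re) : 1 - κ ≤ (β + x).re := by
  simp only [Complex.add_re, Complex.ofReal_re]
  linarith

theorem ne_zero_of_le_re {c : ℝ} (hc : 0 < c) (h : c ≤ x.re) : x ≠ 0 := by
  rintro rfl
  simp only [Complex.zero_re] at h
  linarith

theorem norm_inv_le_of_le_re {c : ℝ} (hc : 0 < c) (h : c ≤ x.re) : ‖x⁻¹‖ ≤ 1 / c := by
  rw [norm_inv, inv_eq_one_div]
  exact one_div_le_one_div_of_le hc (h.trans (Complex.re_le_norm x))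

theorem norm_inv_sub_inv_le {c : ℝ} (hc : 0 < c) (hx : c ≤ x.re) (hy : c ≤ y.re) :
    ‖x⁻¹ - y⁻¹‖ ≤ 1 / c ^ 2 * ‖x - y‖ := by
  rw [inv_sub_inv (ne_zero_of_le_re hc hx) (ne_zero_of_le_re hc hy), div_eq_mul_inv, mul_inv,
    norm_mul, norm_mul, norm_sub_rev y x, mul_comm]
  gcongr
  calc ‖x⁻¹‖ * ‖y⁻¹‖ ≤ 1 / c * (1 / c) := by
        gcongr <;> exact norm_inv_le_of_le_re hc (by assumption)
    _ = 1 / c ^ 2 := by ring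

theorem norm_negLogRatioDeriv_le (hβ : 1 ≤ β) (hγ0 : 0 ≤ γ) (hγ1 : γ ≤ 1) (hκ0 : 0 ≤ κ)
    (hκ1 : κ < 1) (hx : -κ < x.re) : ‖negLogRatioDeriv β γ x‖ ≤ 2 / (1 - κ) := by
  have hc : 0 < 1 - κ := by linarith
  have h1 := norm_inv_le_of_le_re hc (one_sub_le_re_add hβ hx)
  have h2 := norm_inv_le_of_le_re hc (one_sub_le_re_one_add hγ0 hγ1 hκ0 hx)
  calc ‖negLogRatioDeriv β γ x‖ ≤ ‖((β : ℂ) + x)⁻¹‖ + ‖(γ : ℂ) * (1 + γ * x)⁻¹‖ := norm_sub_le _ _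
    _ ≤ 1 / (1 - κ) + 1 * (1 / (1 - κ)) := by
        rw [norm_mul, Complex.norm_real, Real.norm_of_nonneg hγ0]
        gcongr
    _ = 2 / (1 - κ) := by ring

theorem norm_negLogRatioDeriv_sub_le (hβ : 1 ≤ β) (hγ0 : 0 ≤ γ) (hγ1 : γ ≤ 1) (hκ0 : 0 ≤ κ)
    (hκ1 : κ < 1) (hx : -κ < x.re) (hy : -κ < y.re) :
    ‖negLogRatioDeriv β γ x - negLogRatioDeriv β γ y‖ ≤ 2 / (1 - κ) ^ 2 * ‖x - y‖ := by
  have hc : 0 < 1 - κ := by linarith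
  have h1 := norm_inv_sub_inv_le hc (one_sub_le_re_add hβ hx) (one_sub_le_re_add hβ hy)
  have h2 := norm_inv_sub_inv_le hc (one_sub_le_re_one_add hγ0 hγ1 hκ0 hx)
    (one_sub_le_re_one_add hγ0 hγ1 hκ0 hy)
  rw [show (β : ℂ) + x - (β + y) = x - y by ring] at h1
  rw [show 1 + (γ : ℂ) * x - (1 + γ * y) = γ * (x - y) by ring, norm_mul, Complex.norm_real,
    Real.norm_of_nonneg hγ0] at h2
  have hB : 0 ≤ 1 / (1 - κ) ^ 2 * ‖x - y‖ := by positivity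
  calc ‖negLogRatioDeriv β γ x - negLogRatioDeriv β γ y‖
      = ‖((β + x)⁻¹ - (β + y)⁻¹) - (γ : ℂ) * ((1 + γ * x)⁻¹ - (1 + γ * y)⁻¹)‖ := by
        unfold negLogRatioDeriv; ring_nf
    _ ≤ 1 / (1 - κ) ^ 2 * ‖x - y‖ + γ * (1 / (1 - κ) ^ 2 * (γ * ‖x - y‖)) := by
        refine (norm_sub_le _ _).trans (add_le_add h1 ?_)
        rw [norm_mul, Complex.norm_real, Real.norm_of_nonneg hγ0]
        gcongr
    _ ≤ 2 / (1 - κ) ^ 2 * ‖x - y‖ := by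
        have : γ * γ ≤ 1 := by nlinarith
        calc _ = (1 + γ * γ) * (1 / (1 - κ) ^ 2 * ‖x - y‖) := by ring
          _ ≤ 2 * (1 / (1 - κ) ^ 2 * ‖x - y‖) := by gcongr; linarith
          _ = _ := by ring

theorem hasDerivAt_negLogRatio (hβ : 1 ≤ β) (hγ0 : 0 ≤ γ) (hγ1 : γ ≤ 1) (hκ0 : 0 ≤ κ)
    (hκ1 : κ < 1) (hx : -κ < x.re) :
    HasDerivAt (negLogRatio β γ) (negLogRatioDeriv β γ x) x := by
  have hc : 0 < 1 - κ := by linarith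
  have h1 : ((β : ℂ) + x) ∈ Complex.slitPlane :=
    Complex.mem_slitPlane_iff.2 (Or.inl (hc.trans_le (one_sub_le_re_add hβ hx)))
  have h2 : (1 + (γ : ℂ) * x) ∈ Complex.slitPlane :=
    Complex.mem_slitPlane_iff.2 (Or.inl (hc.trans_le (one_sub_le_re_one_add hγ0 hγ1 hκ0 hx)))
  have d1 := ((hasDerivAt_id x).const_add (β : ℂ)).clog h1
  have d2 := (((hasDerivAt_id x).const_mul (γ : ℂ)).const_add 1).clog h2
  have d := d1.sub d2
  simp only [id, mul_one] at d
  exact d.congr_deriv (by unfold negLogRatioDeriv; ring)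

theorem norm_negLogRatio_sub_le (hβ : 1 ≤ β) (hγ0 : 0 ≤ γ) (hγ1 : γ ≤ 1) (hκ0 : 0 ≤ κ)
    (hκ1 : κ < 1) (hx : -κ < x.re) (hy : -κ < y.re) :
    ‖negLogRatio β γ x - negLogRatio β γ y‖ ≤ 2 / (1 - κ) * ‖x - y‖ :=
  (convex_halfSpace_re_gt (-κ)).norm_image_sub_le_of_norm_hasDerivWithin_le
    (fun _ hz => (hasDerivAt_negLogRatio hβ hγ0 hγ1 hκ0 hκ1 hz).hasDerivWithinAt)
    (fun _ hz => norm_negLogRatioDeriv_le hβ hγ0 hγ1 hκ0 hκ1 hz) hy hx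

theorem exp_neg_negLogRatio (hβ : 1 ≤ β) (hγ0 : 0 ≤ γ) (hγ1 : γ ≤ 1) (hκ0 : 0 ≤ κ)
    (hκ1 : κ < 1) (hx : -κ < x.re) :
    Complex.exp (-negLogRatio β γ x) = (1 + γ * x) / (β + x) := by
  have hc : 0 < 1 - κ := by linarith
  rw [negLogRatio, neg_sub, Complex.exp_sub,
    Complex.exp_log (ne_zero_of_le_re hc (one_sub_le_re_add hβ hx)),
    Complex.exp_log (ne_zero_of_le_re hc (one_sub_le_re_one_add hγ0 hγ1 hκ0 hx))]

end HalfPlane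

/-! ### From real contraction to complex zero-freeness -/

/-- As ε ≤ 1/2, the decay exp(-R) beats the error growth exp(εR). The leftover exp(-R/2) absorbs
powers of R, making later estimates uniform over the unbounded cone. -/
theorem norm_mul_exp_neg_sub_le {lam : ℂ} {l δ ε R : ℝ} {S : ℂ} (hR : 0 ≤ R) (hε0 : 0 ≤ ε)
    (hε : ε ≤ 1 / 2) (hlam : ‖lam - l‖ ≤ δ) (hS : ‖S - R‖ ≤ ε * R) :
    ‖lam * Complex.exp (-S) - l * Complex.exp (-R)‖ ≤
      Real.exp (-(R / 2)) * (δ + |l| * (ε * R)) := by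
  have hz : ‖-(S - (R : ℂ))‖ ≤ ε * R := by rwa [norm_neg]
  generalize hzdef : -(S - (R : ℂ)) = z at hz
  have e : Complex.exp (-S) = Complex.exp (-R) * Complex.exp z := by
    rw [← Complex.exp_add, ← hzdef]; congr 1; ring
  have h1 : ‖Complex.exp z‖ ≤ Real.exp (ε * R) :=
    (Complex.norm_exp_le_exp_norm z).trans (Real.exp_le_exp.2 hz)
  have h2 : ‖Complex.exp z - 1‖ ≤ ε * R * Real.exp (ε * R) := by
    have := Complex.norm_exp_sub_sum_le_norm_mul_exp z 1
    simp only [Finset.sum_range_one, pow_zero, Nat.factorial_zero, Nat.cast_one, div_one,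
      pow_one] at this
    refine this.trans ?_
    gcongr
  have h3 : ‖Complex.exp (-(R : ℂ))‖ = Real.exp (-R) := by
    rw [Complex.norm_exp]; simp
  have hδ : 0 ≤ δ := (norm_nonneg _).trans hlam
  calc ‖lam * Complex.exp (-S) - l * Complex.exp (-R)‖
      = ‖Complex.exp (-(R : ℂ)) * ((lam - l) * Complex.exp z + l * (Complex.exp z - 1))‖ := by
        rw [e]; ring_nf
    _ ≤ Real.exp (-R) * (δ * Real.exp (ε * R) + |l| * (ε * R * Real.exp (ε * R))) := by
        rw [norm_mul, h3]
        gcongr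
        refine (norm_add_le _ _).trans ?_
        rw [norm_mul, norm_mul, Complex.norm_real, Real.norm_eq_abs]
        gcongr
    _ = Real.exp (-R + ε * R) * (δ + |l| * (ε * R)) := by rw [Real.exp_add]; ring
    _ ≤ Real.exp (-(R / 2)) * (δ + |l| * (ε * R)) := by
        gcongr
        nlinarith

theorem mul_exp_neg_half_le {R : ℝ} : R * Real.exp (-(R / 2)) ≤ 2 := by
  have h := Real.add_one_le_exp (R / 2)
  rw [Real.exp_neg, ← div_eq_mul_inv, div_le_iff₀ (Real.exp_pos _)]
  linarith

theorem sq_mul_exp_neg_half_le {R : ℝ} (hR : 0 ≤ R) : R ^ 2 * Real.exp (-(R / 2)) ≤ 8 := by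
  have h := Real.quadratic_le_exp_of_nonneg (x := R / 2) (by linarith)
  rw [Real.exp_neg, ← div_eq_mul_inv, div_le_iff₀ (Real.exp_pos _)]
  nlinarith

/-- The real contraction condition, in its quantitative form. -/
theorem exists_contraction_gap {β γ l₀ : ℝ} (hβ : 1 ≤ β) (hγ0 : 0 ≤ γ) (hγ1 : γ ≤ 1)
    (hl₀ : -1 < l₀)
    (H : ∀ s ∈ Set.Icc (0 : ℝ) 1, Real.negMulLog s * |l₀| *
      |(β + l₀ * s)⁻¹ - γ * (1 + γ * (l₀ * s))⁻¹| <
        Real.log (β + l₀ * s) - Real.log (1 + γ * (l₀ * s))) :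
    ∃ η > 0, ∀ s ∈ Set.Icc (0 : ℝ) 1, Real.negMulLog s * |l₀| *
      |(β + l₀ * s)⁻¹ - γ * (1 + γ * (l₀ * s))⁻¹| + η ≤
        Real.log (β + l₀ * s) - Real.log (1 + γ * (l₀ * s)) := by
  have hls : ∀ s ∈ Set.Icc (0 : ℝ) 1, -1 < l₀ * s := by
    rintro s ⟨h0, h1⟩
    by_cases h : 0 ≤ l₀
    · nlinarith
    · nlinarith
  have hp1 : ∀ s ∈ Set.Icc (0 : ℝ) 1, β + l₀ * s ≠ 0 := fun s hs => by
    linarith [hls s hs]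
  have hp2 : ∀ s ∈ Set.Icc (0 : ℝ) 1, 1 + γ * (l₀ * s) ≠ 0 := fun s hs => by
    have := hls s hs
    rcases le_total 0 (l₀ * s) with h | h
    · positivity
    · nlinarith
  -- Continuity holds up to s = 0, which stands for R = ∞, so compactness yields a gap uniform in R.
  have hcont : ContinuousOn (fun s => Real.log (β + l₀ * s) - Real.log (1 + γ * (l₀ * s)) -
      Real.negMulLog s * |l₀| * |(β + l₀ * s)⁻¹ - γ * (1 + γ * (l₀ * s))⁻¹|) (Set.Icc 0 1) := by
    have c1 : ContinuousOn (fun s : ℝ => β + l₀ * s) (Set.Icc 0 1) := by fun_prop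
    have c2 : ContinuousOn (fun s : ℝ => 1 + γ * (l₀ * s)) (Set.Icc 0 1) := by fun_prop
    exact ((c1.log hp1).sub (c2.log hp2)).sub
      ((Real.continuous_negMulLog.continuousOn.mul continuousOn_const).mul
        ((c1.inv₀ hp1).sub (continuousOn_const.mul (c2.inv₀ hp2))).abs)
  obtain ⟨s₀, hs₀, hmin⟩ := isCompact_Icc.exists_isMinOn ⟨0, by simp⟩ hcont
  refine ⟨_, sub_pos.2 (H s₀ hs₀), fun s hs => ?_⟩
  have := isMinOn_iff.1 hmin s hs
  linarith

/-- The quantitative real contraction condition survives complex perturbations. -/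
theorem norm_negLogRatio_mul_exp_sub_le {β γ κ η θ δ ε l₀ s R : ℝ} {lam S : ℂ} (hβ : 1 ≤ β)
    (hγ0 : 0 ≤ γ) (hγ1 : γ ≤ 1) (hκ0 : 0 ≤ κ) (hκ1 : κ < 1) (hs : s ∈ Set.Icc (0 : ℝ) 1)
    (hκ : -κ + θ < l₀ * (s * Real.exp (-R)))
    (gap : ∀ s ∈ Set.Icc (0 : ℝ) 1, Real.negMulLog s * |l₀| *
      |(β + l₀ * s)⁻¹ - γ * (1 + γ * (l₀ * s))⁻¹| + η ≤
        Real.log (β + l₀ * s) - Real.log (1 + γ * (l₀ * s)))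
    (hR : 0 ≤ R) (hε0 : 0 ≤ ε) (hε : ε ≤ 1 / 2) (hθ : 2 * δ + 8 * |l₀| * ε ≤ θ)
    (hθη : θ * (2 / (1 - κ) + |l₀| * (2 / (1 - κ) ^ 2)) ≤ η / 2)
    (hδη : 2 / (1 - κ) * δ ≤ ε * (η / 2))
    (hlam : ‖lam - ((l₀ * s : ℝ) : ℂ)‖ ≤ δ) (hS : ‖S - R‖ ≤ ε * R) :
    -κ < (lam * Complex.exp (-S)).re ∧
    ∃ r : ℝ, 0 ≤ r ∧ ‖negLogRatio β γ (lam * Complex.exp (-S)) - r‖ ≤ ε * r := by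
  have hc : 0 < 1 - κ := by linarith
  have hδ : 0 ≤ δ := (norm_nonneg _).trans hlam
  have hexp1 : Real.exp (-R) ≤ 1 := Real.exp_le_one_iff.2 (by linarith)
  set q := s * Real.exp (-R) with hq
  have hq0 : 0 ≤ q := mul_nonneg hs.1 (Real.exp_nonneg _)
  have hqI : q ∈ Set.Icc (0 : ℝ) 1 :=
    ⟨hq0, mul_le_one₀ hs.2 (Real.exp_nonneg _) hexp1⟩
  have habs : |l₀ * s| ≤ |l₀| := by
    rw [abs_mul, abs_of_nonneg hs.1]
    exact mul_le_of_le_one_right (abs_nonneg _) hs.2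
  -- the unperturbed ratio
  set x : ℝ := l₀ * q with hx
  have hxl : ((l₀ * s : ℝ) : ℂ) * Complex.exp (-(R : ℂ)) = x := by
    rw [hx, hq]; push_cast; ring
  have hθ0 : 0 ≤ θ := le_trans (by positivity) hθ
  have hxre : -κ < ((x : ℝ) : ℂ).re := by rw [Complex.ofReal_re]; linarith
  -- Since s ≤ 1, R ≤ -log q. Hence the inequality for the endpoint `l₀`, taken at `q`, also serves
  -- the activity `l₀ * s`.
  have hRq : R * q ≤ Real.negMulLog q := by
    rcases hs.1.eq_or_lt with h0 | h0
    · simp [hq, ← h0]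
    · have hl : Real.log q = Real.log s - R := by
        rw [hq, Real.log_mul h0.ne' (Real.exp_pos _).ne', Real.log_exp]; ring
      rw [Real.negMulLog, hl]
      nlinarith [Real.log_nonpos hs.1 hs.2]
  set r : ℝ := Real.log (β + x) - Real.log (1 + γ * x) with hr
  have hp1 : 0 < β + x := by
    have := one_sub_le_re_add hβ hxre
    simp at this; linarith
  have hp2 : 0 < 1 + γ * x := by
    have := one_sub_le_re_one_add hγ0 hγ1 hκ0 hxre
    simp at this; linarith
  have hgx : negLogRatio β γ x = r := by
    rw [negLogRatio, hr, Complex.ofReal_sub, Complex.ofReal_log hp1.le, Complex.ofReal_log hp2.le]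
    push_cast; rfl
  have hg'x : ‖negLogRatioDeriv β γ x‖ = |(β + x)⁻¹ - γ * (1 + γ * x)⁻¹| := by
    rw [← Real.norm_eq_abs, ← Complex.norm_real, negLogRatioDeriv]
    push_cast; rfl
  have hcontr : R * (‖(x : ℂ)‖ * ‖negLogRatioDeriv β γ x‖) ≤ r - η := by
    have h1 : R * (‖(x : ℂ)‖ * ‖negLogRatioDeriv β γ x‖) ≤
        Real.negMulLog q * |l₀| * |(β + x)⁻¹ - γ * (1 + γ * x)⁻¹| := by
      rw [hg'x, Complex.norm_real, Real.norm_eq_abs, hx, abs_mul, abs_of_nonneg hq0]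
      calc _ = R * q * |l₀| * |(β + l₀ * q)⁻¹ - γ * (1 + γ * (l₀ * q))⁻¹| := by ring
        _ ≤ _ := by gcongr
    linarith [gap q hqI]
  have hr0 : 0 ≤ r := by
    have h1 := gap q hqI
    have h2 : 0 ≤ Real.negMulLog q := Real.negMulLog_nonneg hqI.1 hqI.2
    have h3 : 0 ≤ η := by
      have : 0 ≤ θ * (2 / (1 - κ) + |l₀| * (2 / (1 - κ) ^ 2)) := by positivity
      linarith
    have h4 : 0 ≤ Real.negMulLog q * |l₀| * |(β + l₀ * q)⁻¹ - γ * (1 + γ * (l₀ * q))⁻¹| := by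
      positivity
    linarith
  -- the perturbed ratios
  have hclose : ∀ S' : ℂ, ‖S' - R‖ ≤ ε * R →
      ‖lam * Complex.exp (-S') - x‖ ≤ θ ∧ R * ‖lam * Complex.exp (-S') - x‖ ≤ θ := by
    intro S' hS'
    have h := norm_mul_exp_neg_sub_le hR hε0 hε hlam hS'
    rw [hxl] at h
    have he1 : Real.exp (-(R / 2)) ≤ 1 := Real.exp_le_one_iff.2 (by linarith)
    have he2 := mul_exp_neg_half_le (R := R)
    have he3 := sq_mul_exp_neg_half_le hR
    have hE := Real.exp_nonneg (-(R / 2))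
    have h' : ‖lam * Complex.exp (-S') - x‖ ≤
        Real.exp (-(R / 2)) * (δ + |l₀| * (ε * R)) := h.trans (by gcongr)
    have hle : 0 ≤ |l₀| * ε := by positivity
    constructor
    · calc _ ≤ _ := h'
        _ = Real.exp (-(R / 2)) * δ + |l₀| * ε * (R * Real.exp (-(R / 2))) := by ring
        _ ≤ 1 * δ + |l₀| * ε * 2 := by gcongr
        _ ≤ θ := by linarith
    · calc _ ≤ R * (Real.exp (-(R / 2)) * (δ + |l₀| * (ε * R))) := by gcongr
        _ = (R * Real.exp (-(R / 2))) * δ + |l₀| * ε * (R ^ 2 * Real.exp (-(R / 2))) := by ring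
        _ ≤ 2 * δ + |l₀| * ε * 8 := by gcongr
        _ ≤ θ := by linarith
  have hre : ∀ S' : ℂ, ‖S' - R‖ ≤ ε * R → -κ < (lam * Complex.exp (-S')).re := by
    intro S' hS'
    have h := (Complex.abs_re_le_norm _).trans (hclose S' hS').1
    rw [Complex.sub_re, Complex.ofReal_re] at h
    linarith [(abs_le.1 h).1]
  have hderiv : ∀ S' : ℂ, ‖S' - R‖ ≤ ε * R →
      R * ‖lam * Complex.exp (-S') * negLogRatioDeriv β γ (lam * Complex.exp (-S'))‖ ≤
        r - η / 2 := by
    intro S' hS'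
    obtain ⟨h1, h2⟩ := hclose S' hS'
    generalize hx' : lam * Complex.exp (-S') = x' at h1 h2 ⊢
    have hx're : -κ < x'.re := hx' ▸ hre S' hS'
    have b1 := norm_negLogRatioDeriv_le hβ hγ0 hγ1 hκ0 hκ1 hx're
    have b2 := norm_negLogRatioDeriv_sub_le hβ hγ0 hγ1 hκ0 hκ1 hx're hxre
    have b3 : ‖(x : ℂ)‖ ≤ |l₀| := by
      rw [Complex.norm_real, Real.norm_eq_abs, hx, abs_mul, abs_of_nonneg hq0]
      exact mul_le_of_le_one_right (abs_nonneg _) hqI.2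
    calc R * ‖x' * negLogRatioDeriv β γ x'‖
        = R * ‖x * negLogRatioDeriv β γ x + (x' - x) * negLogRatioDeriv β γ x' +
            x * (negLogRatioDeriv β γ x' - negLogRatioDeriv β γ x)‖ := by ring_nf
      _ ≤ R * (‖(x : ℂ)‖ * ‖negLogRatioDeriv β γ x‖ + ‖x' - x‖ * (2 / (1 - κ)) +
            |l₀| * (2 / (1 - κ) ^ 2 * ‖x' - x‖)) := by
          gcongr
          refine norm_add₃_le.trans ?_
          rw [norm_mul, norm_mul, norm_mul]
          gcongr
      _ = R * (‖(x : ℂ)‖ * ‖negLogRatioDeriv β γ x‖) +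
            (R * ‖x' - x‖) * (2 / (1 - κ) + |l₀| * (2 / (1 - κ) ^ 2)) := by ring
      _ ≤ (r - η) + θ * (2 / (1 - κ) + |l₀| * (2 / (1 - κ) ^ 2)) := by gcongr
      _ ≤ r - η / 2 := by linarith
  refine ⟨hre S hS, r, hr0, ?_⟩
  -- the segment from `R` to `S`
  have hseg : ∀ t ∈ Set.Icc (0 : ℝ) 1, ‖((R : ℂ) + t * (S - R)) - R‖ ≤ ε * R := by
    intro t ht
    rw [add_sub_cancel_left, norm_mul, Complex.norm_real, Real.norm_of_nonneg ht.1]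
    exact (mul_le_of_le_one_left (norm_nonneg _) ht.2).trans hS
  have hpath : ∀ t ∈ Set.Icc (0 : ℝ) 1, HasDerivWithinAt
      (fun t : ℝ => negLogRatio β γ (lam * Complex.exp (-((R : ℂ) + t * (S - R)))))
      (-(S - R) * (lam * Complex.exp (-((R : ℂ) + t * (S - R))) *
        negLogRatioDeriv β γ (lam * Complex.exp (-((R : ℂ) + t * (S - R))))))
      (Set.Icc 0 1) t := by
    intro t ht
    have d1 : HasDerivAt (fun t : ℝ => -((R : ℂ) + t * (S - R))) (-(S - R)) t := by
      have := ((Complex.ofRealCLM.hasDerivAt (x := t)).mul_const (S - R)).const_add (R : ℂ)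
      exact this.fun_neg.congr_deriv (by simp)
    have d2 := d1.cexp.const_mul lam
    have d3 := (hasDerivAt_negLogRatio hβ hγ0 hγ1 hκ0 hκ1 (hre _ (hseg t ht))).comp t d2
    exact (d3.congr_deriv (by ring)).hasDerivWithinAt
  -- The segment has length at most εR, and R times the derivative is at most r - η/2. The unused
  -- εη/2 pays for `lam` being off the real axis, in `hbase`.
  have hmv := norm_image_sub_le_of_norm_deriv_le_segment_01' hpath (C := ε * (r - η / 2))
    fun t ht => by
      have h := hderiv _ (hseg t ⟨ht.1, ht.2.le⟩)
      rw [norm_mul, norm_neg]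
      calc _ ≤ ε * R * ‖_‖ := mul_le_mul_of_nonneg_right hS (norm_nonneg _)
        _ = ε * (R * ‖_‖) := mul_assoc _ _ _
        _ ≤ _ := mul_le_mul_of_nonneg_left h hε0
  simp only [Complex.ofReal_one, one_mul, add_sub_cancel, Complex.ofReal_zero, zero_mul,
    add_zero] at hmv
  have hbase : ‖negLogRatio β γ (lam * Complex.exp (-(R : ℂ))) - r‖ ≤ ε * (η / 2) := by
    rw [← hgx]
    refine (norm_negLogRatio_sub_le hβ hγ0 hγ1 hκ0 hκ1
      (hre R (by simp only [sub_self, norm_zero]; positivity)) hxre).trans (le_trans ?_ hδη)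
    gcongr
    rw [← hxl, ← sub_mul, norm_mul, Complex.norm_exp]
    simp only [Complex.neg_re, Complex.ofReal_re]
    exact (mul_le_of_le_one_right (norm_nonneg _) hexp1).trans hlam
  calc _ ≤ _ := norm_sub_le_norm_sub_add_norm_sub _
        (negLogRatio β γ (lam * Complex.exp (-(R : ℂ)))) _
    _ ≤ ε * (r - η / 2) + ε * (η / 2) := add_le_add hmv hbase
    _ = ε * r := by ring

/-- The real contraction condition implies that there are no zeros near the segment `[0, l₀]`. -/
theorem exists_zeroFree_of_contraction {β γ l₀ : ℝ} (hβ : 1 ≤ β) (hγ0 : 0 ≤ γ) (hγ1 : γ ≤ 1)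
    (hl₀ : -1 < l₀)
    (H : ∀ s ∈ Set.Icc (0 : ℝ) 1, Real.negMulLog s * |l₀| *
      |(β + l₀ * s)⁻¹ - γ * (1 + γ * (l₀ * s))⁻¹| <
        Real.log (β + l₀ * s) - Real.log (1 + γ * (l₀ * s))) :
    ∃ δ : ℝ, 0 < δ ∧
      ∀ lam : ℂ, lam ∈ Metric.thickening δ (segment ℝ (0 : ℂ) (l₀ : ℂ)) → lam ≠ 0 →
        ∀ (V : Type*) [Fintype V] (G : SimpleGraph V) (S : Set V) (τ : S → Fin 2),
          Feasible β γ G S τ → partitionFunction β γ G S τ lam ≠ 0 := by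
  obtain ⟨η, hη, gap⟩ := exists_contraction_gap hβ hγ0 hγ1 hl₀ H
  set m := max (-l₀) 0 with hm
  have hm0 : 0 ≤ m := le_max_right _ _
  have hm1 : m < 1 := max_lt (by linarith) one_pos
  have hml : -m ≤ l₀ := by linarith [le_max_left (-l₀) 0]
  -- Real ratios are at least -m. Taking κ midway between m and 1 leaves room for perturbation on
  -- one side and nonzero denominators on the other.
  set κ := (1 + m) / 2 with hκdef
  have hκ0 : 0 ≤ κ := by positivity
  have hκ1 : κ < 1 := by rw [hκdef]; linarith
  have hc : 0 < 1 - κ := by linarith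
  set K := 2 / (1 - κ) + |l₀| * (2 / (1 - κ) ^ 2) with hK
  have hKpos : 0 < K := by positivity
  set A := 2 + 8 * |l₀| with hA
  have hApos : 0 < A := by positivity
  -- The perturbation size θ will be A ε: the second bound keeps ratios in the half-plane, the third
  -- makes the derivative error at most η/2.
  set ε := min (1 / 2) (min ((κ - m) / (2 * A)) (η / (2 * A * K))) with hεdef
  have hκm : 0 < κ - m := by rw [hκdef]; linarith
  have hεpos : 0 < ε := by positivity
  have hε1 : ε ≤ 1 / 2 := min_le_left _ _
  have hε2 : A * ε < κ - m := by
    have : ε ≤ (κ - m) / (2 * A) := (min_le_right _ _).trans (min_le_left _ _)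
    rw [le_div_iff₀ (by positivity)] at this
    linarith
  have hε3 : A * ε * K ≤ η / 2 := by
    have : ε ≤ η / (2 * A * K) := (min_le_right _ _).trans (min_le_right _ _)
    rw [le_div_iff₀ (by positivity)] at this
    linarith
  set δ := min ε (ε * (η / 2) / (2 / (1 - κ))) with hδdef
  have hδpos : 0 < δ := by positivity
  have hδε : δ ≤ ε := min_le_left _ _
  have hδη : 2 / (1 - κ) * δ ≤ ε * (η / 2) := by
    have : δ ≤ ε * (η / 2) / (2 / (1 - κ)) := min_le_right _ _
    rw [le_div_iff₀ (by positivity)] at this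
    linarith
  refine ⟨δ, hδpos, fun lam hlam hlam0 V _ G S τ hτ => ?_⟩
  obtain ⟨z, hz, hzlam⟩ := Metric.mem_thickening_iff.1 hlam
  rw [segment_eq_image] at hz
  obtain ⟨s, hs, rfl⟩ := hz
  have hlam' : ‖lam - ((l₀ * s : ℝ) : ℂ)‖ ≤ δ := by
    rw [dist_eq_norm] at hzlam
    refine le_trans (le_of_eq ?_) hzlam.le
    simp [mul_comm]
  have step : ∀ M ∈ coneMonoid ε, -κ < (lam * M).re ∧
      (1 + (γ : ℂ) * (lam * M)) / (β + lam * M) ∈ coneMonoid ε := by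
    rintro M (rfl | ⟨S, R, hR, hS, rfl⟩)
    · refine ⟨by simp only [mul_zero, Complex.zero_re]; linarith, ?_⟩
      have := ofReal_mem_coneMonoid hεpos.le (inv_nonneg.2 (zero_le_one.trans hβ))
        (inv_le_one_of_one_le₀ hβ)
      simpa using this
    · have hx : -κ + A * ε < l₀ * (s * Real.exp (-R)) := by
        have he1 : Real.exp (-R) ≤ 1 := Real.exp_le_one_iff.2 (by linarith)
        have h0 : 0 ≤ s * Real.exp (-R) := mul_nonneg hs.1 (Real.exp_nonneg _)
        have h1 : s * Real.exp (-R) ≤ 1 := mul_le_one₀ hs.2 (Real.exp_nonneg _) he1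
        nlinarith
      obtain ⟨h1, r, hr, h2⟩ := norm_negLogRatio_mul_exp_sub_le hβ hγ0 hγ1 hκ0 hκ1 hs hx gap hR
        hεpos.le hε1 (by rw [hA]; linarith) hε3 hδη hlam' hS
      exact ⟨h1, Or.inr ⟨_, r, hr, h2, (exp_neg_negLogRatio hβ hγ0 hγ1 hκ0 hκ1 h1).symm⟩⟩
  refine partitionFunction_ne_zero G (by linarith) hlam0 (coneMonoid ε) ?_
    (ofReal_mem_coneMonoid hεpos.le hγ0 hγ1) (fun M hM => ?_) (fun M hM => ?_)
    (fun M hM => (step M hM).2) S τ hτ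
  · rw [← Complex.ofReal_inv]
    exact ofReal_mem_coneMonoid hεpos.le (inv_nonneg.2 (zero_le_one.trans hβ))
      (inv_le_one_of_one_le₀ hβ)
  · refine ne_zero_of_le_re hc ?_
    rw [Complex.add_re, Complex.one_re]
    linarith [(step M hM).1]
  · exact ne_zero_of_le_re hc (one_sub_le_re_add hβ (step M hM).1)

/-! ### The real contraction condition -/

/-- The function `log ((β + x) / (1 + γ x))`. -/
noncomputable def logRatio (β γ x : ℝ) : ℝ := Real.log (β + x) - Real.log (1 + γ * x)

theorem one_sub_inv_le_logRatio {β γ x : ℝ} (h1 : 0 < β + x) (h2 : 0 < 1 + γ * x) :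
    (β - 1 + x * (1 - γ)) / (β + x) ≤ logRatio β γ x := by
  have h := Real.one_sub_inv_le_log_of_pos (div_pos h1 h2)
  rw [Real.log_div h1.ne' h2.ne', inv_div] at h
  refine le_trans (le_of_eq ?_) h
  field_simp
  ring

theorem inv_sub_mul_inv_eq {β γ x : ℝ} (h1 : β + x ≠ 0) (h2 : 1 + γ * x ≠ 0) :
    (β + x)⁻¹ - γ * (1 + γ * x)⁻¹ = (1 - β * γ) / ((1 + γ * x) * (β + x)) := by
  rw [eq_div_iff (mul_ne_zero h2 h1)]
  linear_combination (1 + γ * x) * mul_inv_cancel₀ h1 -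
    γ * (β + x) * mul_inv_cancel₀ h2

/-- The bound log y ≥ 1 - 1/y, applied to s and to (β + x)/(1 + γx), reduces the claim to a
polynomial inequality. For βγ ≤ 1, `hT` makes the lower bound for the logarithm positive at s = 1.
-/
theorem contraction_of_neg {β γ l₀ : ℝ} (hβ : 1 < β) (hγ0 : 0 ≤ γ) (hγ1 : γ ≤ 1)
    (hl₀ : -1 < l₀) (hl : l₀ < 0) (hT : β * γ ≤ 1 → 0 < β - 1 + l₀ * (1 - γ)) :
    ∀ s ∈ Set.Icc (0 : ℝ) 1, Real.negMulLog s * |l₀| *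
      |(β + l₀ * s)⁻¹ - γ * (1 + γ * (l₀ * s))⁻¹| < logRatio β γ (l₀ * s) := by
  rintro s ⟨hs0, hs1⟩
  rw [abs_of_neg hl]
  set t := -l₀ with ht
  have htl : l₀ = -t := by rw [ht, neg_neg]
  rw [htl] at hT hl₀ hl ⊢
  have ht0 : 0 < t := by linarith
  have ht1 : t < 1 := by linarith
  have hst : t * s ≤ t := mul_le_of_le_one_right ht0.le hs1
  have hst0 : 0 ≤ t * s := by positivity
  have h1 : 0 < β + -t * s := by nlinarith
  have h2 : 0 < 1 + γ * (-t * s) := by nlinarith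
  have hent : Real.negMulLog s * t ≤ t - t * s := by
    rcases hs0.eq_or_lt with rfl | hs0
    · simpa using ht0.le
    · have := Real.one_sub_inv_le_log_of_pos hs0
      rw [Real.negMulLog]
      have h : -s * Real.log s ≤ 1 - s := by
        have : s * (1 - s⁻¹) ≤ s * Real.log s := by gcongr
        rw [mul_sub, mul_inv_cancel₀ hs0.ne'] at this
        linarith
      nlinarith
  rw [inv_sub_mul_inv_eq h1.ne' h2.ne', abs_div, abs_of_pos (mul_pos h2 h1)]
  refine lt_of_lt_of_le ?_ (one_sub_inv_le_logRatio h1 h2)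
  rw [← mul_div_assoc, div_lt_div_iff₀ (mul_pos h2 h1) h1]
  -- For βγ ≤ 1, |1 - βγ| is compared with (1 - γ) times the second factor on the right; for βγ ≥ 1,
  -- with the first factor.
  have key : (t - t * s) * |1 - β * γ| < (β - 1 + -t * s * (1 - γ)) * (1 + γ * (-t * s)) := by
    rcases le_total (β * γ) 1 with h | h
    · have hT' := hT h
      rw [abs_of_nonneg (by linarith)]
      have hγ1' : γ < 1 := by nlinarith
      have e1 : (t - t * s) * (1 - γ) < β - 1 + -t * s * (1 - γ) := by nlinarith
      have e2 : 1 - β * γ ≤ (1 - γ) * (1 + γ * (-t * s)) := by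
        have : t * s * (1 - γ) ≤ β - 1 := by nlinarith
        nlinarith
      have e3 : 0 ≤ t - t * s := by linarith
      calc (t - t * s) * (1 - β * γ) ≤ (t - t * s) * ((1 - γ) * (1 + γ * (-t * s))) := by gcongr
        _ = (t - t * s) * (1 - γ) * (1 + γ * (-t * s)) := by ring
        _ < _ := by gcongr
    · rw [abs_of_nonpos (by linarith)]
      have e1 : t - t * s < 1 + γ * (-t * s) := by nlinarith
      have e2 : -(1 - β * γ) ≤ β - 1 + -t * s * (1 - γ) := by
        have : 0 ≤ (β - t * s) * (1 - γ) := mul_nonneg (by linarith) (by linarith)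
        linarith
      have e3 : 0 ≤ t - t * s := by linarith
      have e4 : 0 < β - 1 + -t * s * (1 - γ) := by nlinarith
      calc (t - t * s) * -(1 - β * γ) ≤ (t - t * s) * (β - 1 + -t * s * (1 - γ)) := by gcongr
        _ < (1 + γ * (-t * s)) * (β - 1 + -t * s * (1 - γ)) := by gcongr
        _ = _ := mul_comm _ _
  calc Real.negMulLog s * t * |1 - β * γ| * (β + -t * s)
      ≤ (t - t * s) * |1 - β * γ| * (β + -t * s) := by gcongr
    _ < (β - 1 + -t * s * (1 - γ)) * (1 + γ * (-t * s)) * (β + -t * s) := by gcongr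
    _ = _ := by ring

theorem logRatio_pos {β γ x : ℝ} (hβ : 1 < β) (hγ0 : 0 ≤ γ) (hγ1 : γ ≤ 1) (hx : 0 ≤ x) :
    0 < logRatio β γ x := by
  refine sub_pos.2 (Real.log_lt_log (by positivity) ?_)
  nlinarith

/-- The number of children, as a function of the fixed point, for which the univariate tree
recursion has derivative of modulus one. -/
noncomputable def criticalDegree (β γ x : ℝ) : ℝ := (1 + γ * x) * (β + x) / (|1 - β * γ| * x)

/-- The logarithm of the activity for which `x` is a fixed point of the univariate tree recursion
with derivative of modulus one. -/
noncomputable def logCriticalActivity (β γ x : ℝ) : ℝ :=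
  Real.log x + criticalDegree β γ x * logRatio β γ x

/-- For s > 0 put x = l₀ s, so -log s = log l₀ - log x. Clearing denominators turns the contraction
condition into exactly `h x`. -/
theorem contraction_of_pos {β γ l₀ : ℝ} (hβ : 1 < β) (hγ0 : 0 ≤ γ) (hγ1 : γ ≤ 1)
    (hβγ : β * γ ≠ 1) (hl : 0 < l₀) (h : ∀ x, 0 < x → Real.log l₀ < logCriticalActivity β γ x) :
    ∀ s ∈ Set.Icc (0 : ℝ) 1, Real.negMulLog s * |l₀| *
      |(β + l₀ * s)⁻¹ - γ * (1 + γ * (l₀ * s))⁻¹| < logRatio β γ (l₀ * s) := by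
  rintro s ⟨hs0, hs1⟩
  rcases hs0.eq_or_lt with rfl | hs0
  · simpa using logRatio_pos hβ hγ0 hγ1 le_rfl
  have hx : 0 < l₀ * s := by positivity
  have hlog : Real.log l₀ = Real.log (l₀ * s) - Real.log s := by
    rw [Real.log_mul hl.ne' hs0.ne']; ring
  have h' := h _ hx
  rw [hlog, logCriticalActivity, criticalDegree] at h'
  have h1 : 0 < β + l₀ * s := by positivity
  have h2 : 0 < 1 + γ * (l₀ * s) := by positivity
  have h3 : 0 < |1 - β * γ| := abs_pos.2 (sub_ne_zero.2 (Ne.symm hβγ))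
  rw [abs_of_pos hl, inv_sub_mul_inv_eq h1.ne' h2.ne', abs_div, abs_of_pos (mul_pos h2 h1),
    Real.negMulLog, ← mul_div_assoc, div_lt_iff₀ (mul_pos h2 h1)]
  have h4 : -Real.log s <
      (1 + γ * (l₀ * s)) * (β + l₀ * s) / (|1 - β * γ| * (l₀ * s)) * logRatio β γ (l₀ * s) := by
    linarith
  rw [div_mul_eq_mul_div, lt_div_iff₀ (by positivity)] at h4
  linarith

section Derivatives

variable {β γ x : ℝ}

theorem hasDerivAt_logRatio (h1 : β + x ≠ 0) (h2 : 1 + γ * x ≠ 0) :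
    HasDerivAt (logRatio β γ) ((1 - β * γ) / ((1 + γ * x) * (β + x))) x := by
  have d1 := ((hasDerivAt_id x).const_add β).log h1
  have d2 := (((hasDerivAt_id x).const_mul γ).const_add 1).log h2
  refine (d1.sub d2).congr_deriv ?_
  rw [← inv_sub_mul_inv_eq h1 h2]
  simp [div_eq_mul_inv]

theorem hasDerivAt_criticalDegree (hβγ : β * γ ≠ 1) (hx : x ≠ 0) :
    HasDerivAt (criticalDegree β γ) ((γ * x ^ 2 - β) / (|1 - β * γ| * x ^ 2)) x := by
  have h3 : |1 - β * γ| ≠ 0 := abs_ne_zero.2 (sub_ne_zero.2 (Ne.symm hβγ))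
  have d1 := (((hasDerivAt_id x).const_mul γ).const_add 1).mul ((hasDerivAt_id x).const_add β)
  have d := d1.div ((hasDerivAt_id x).const_mul |1 - β * γ|) (mul_ne_zero h3 hx)
  refine d.congr_deriv ?_
  simp only [id, Pi.mul_apply]
  field_simp
  ring

/-- `criticalDegree` times the derivative of `logRatio` is ±1/x, with the sign of 1 - βγ. It cancels
the derivative of log x if βγ > 1 and doubles it if βγ < 1. -/
theorem hasDerivAt_logCriticalActivity (hβγ : β * γ ≠ 1) (hx : x ≠ 0) (h1 : β + x ≠ 0)
    (h2 : 1 + γ * x ≠ 0) :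
    HasDerivAt (logCriticalActivity β γ)
      ((1 + (1 - β * γ) / |1 - β * γ|) / x +
        (γ * x ^ 2 - β) / (|1 - β * γ| * x ^ 2) * logRatio β γ x) x := by
  have h3 : |1 - β * γ| ≠ 0 := abs_ne_zero.2 (sub_ne_zero.2 (Ne.symm hβγ))
  have d := (Real.hasDerivAt_log hx).add
    ((hasDerivAt_criticalDegree hβγ hx).mul (hasDerivAt_logRatio h1 h2))
  refine d.congr_deriv ?_
  have e : criticalDegree β γ x * ((1 - β * γ) / ((1 + γ * x) * (β + x))) =
      (1 - β * γ) / |1 - β * γ| / x := by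
    rw [criticalDegree, div_mul_div_comm, div_div,
      div_eq_div_iff (mul_ne_zero (mul_ne_zero h3 hx) (mul_ne_zero h2 h1)) (mul_ne_zero h3 hx)]
    ring
  rw [e]
  ring

end Derivatives

/-- The ferromagnetic critical activity. -/
theorem log_lt_logCriticalActivity_of_one_lt {β γ l₀ : ℝ} (hβ : 0 < β) (hγ1 : γ ≤ 1)
    (hβγ : 1 < β * γ) (hl : 0 < l₀) (h : l₀ < (β / γ) ^ (√(β * γ) / (√(β * γ) - 1))) {x : ℝ}
    (hx : 0 < x) : Real.log l₀ < logCriticalActivity β γ x := by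
  have hγ : 0 < γ := pos_of_mul_pos_right (by linarith) hβ.le
  have hβ1 : 1 < β := by nlinarith
  set a := √(β * γ) with ha
  have ha2 : a ^ 2 = β * γ := Real.sq_sqrt (by positivity)
  have ha1 : 1 < a := by rw [ha]; exact Real.lt_sqrt_of_sq_lt (by simpa using hβγ)
  -- The minimiser: the derivative of `logCriticalActivity` has the sign of γz² - β.
  set y := √(β / γ) with hy
  have hy0 : 0 < y := Real.sqrt_pos.2 (by positivity)
  have hy2 : y ^ 2 = β / γ := Real.sq_sqrt (by positivity)
  have hγy2 : γ * y ^ 2 = β := by rw [hy2]; field_simp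
  have hγy : γ * y = a := by
    have : (γ * y) ^ 2 = a ^ 2 := by rw [mul_pow, hy2, ha2]; field_simp
    exact (pow_left_inj₀ (by positivity) (by positivity) two_ne_zero).1 this
  have hlogy : Real.log (β / γ) = 2 * Real.log y := by rw [← hy2, Real.log_pow]; norm_num
  have hay : β = a * y := by rw [← hγy2, ← hγy]; ring
  have hval : logCriticalActivity β γ y = Real.log (β / γ) * (a / (a - 1)) := by
    have e1 : logRatio β γ y = Real.log y := by
      rw [logRatio, ← Real.log_div (by positivity) (by positivity)]
      congr 1
      rw [hγy, div_eq_iff (by positivity)]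
      nth_rw 1 [hay]
      ring
    have e2 : criticalDegree β γ y = (1 + a) / (a - 1) := by
      have : 0 < a - 1 := by linarith
      rw [criticalDegree, ← ha2, abs_of_neg (by nlinarith), hγy]
      have h2 : β + y = (a + 1) * y := by rw [add_mul, ← hay, one_mul]
      have h3 : -(1 - a ^ 2) = (a - 1) * (a + 1) := by ring
      rw [h2, h3]
      field_simp
    rw [logCriticalActivity, e1, e2, hlogy]
    have : a - 1 ≠ 0 := by linarith
    field_simp
    ring
  have hlog : Real.log l₀ < logCriticalActivity β γ y := by
    rw [hval, mul_comm, ← Real.log_rpow (by positivity)]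
    exact Real.log_lt_log hl h
  refine hlog.trans_le ?_
  have hder : ∀ z, 0 < z → HasDerivAt (logCriticalActivity β γ)
      ((γ * z ^ 2 - β) / (|1 - β * γ| * z ^ 2) * logRatio β γ z) z := by
    intro z hz
    refine (hasDerivAt_logCriticalActivity hβγ.ne' hz.ne' (by positivity)
      (by positivity)).congr_deriv ?_
    have : 1 - β * γ < 0 := by linarith
    rw [abs_of_neg this, div_neg, div_self this.ne]
    ring
  rcases le_total x y with hxy | hxy
  · refine antitoneOn_of_deriv_nonpos (convex_Icc x y)
      (fun z hz => (hder z (hx.trans_le hz.1)).continuousAt.continuousWithinAt)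
      (fun z hz => ?_) (fun z hz => ?_) (Set.left_mem_Icc.2 hxy) (Set.right_mem_Icc.2 hxy) hxy <;>
      rw [interior_Icc] at hz
    · exact (hder z (hx.trans hz.1)).differentiableAt.differentiableWithinAt
    · have hz0 := hx.trans hz.1
      rw [(hder z hz0).deriv]
      refine mul_nonpos_of_nonpos_of_nonneg (div_nonpos_of_nonpos_of_nonneg ?_ (by positivity))
        (logRatio_pos hβ1 hγ.le hγ1 hz0.le).le
      have := hz.2
      have : γ * z ^ 2 ≤ γ * y ^ 2 := by gcongr
      linarith
  · refine monotoneOn_of_deriv_nonneg (convex_Icc y x)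
      (fun z hz => (hder z (hy0.trans_le hz.1)).continuousAt.continuousWithinAt)
      (fun z hz => ?_) (fun z hz => ?_) (Set.left_mem_Icc.2 hxy) (Set.right_mem_Icc.2 hxy) hxy <;>
      rw [interior_Icc] at hz
    · exact (hder z (hy0.trans hz.1)).differentiableAt.differentiableWithinAt
    · have hz0 := hy0.trans hz.1
      rw [(hder z hz0).deriv]
      refine mul_nonneg (div_nonneg ?_ (by positivity)) (logRatio_pos hβ1 hγ.le hγ1 hz0.le).le
      have := hz.1
      have : γ * y ^ 2 ≤ γ * z ^ 2 := by gcongr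
      linarith

/-! ### The antiferromagnetic threshold -/

section TurningPoint

variable {β γ : ℝ}

theorem exists_turningPoint_logCriticalActivity (hβ : 1 < β) (hγ0 : 0 ≤ γ) (hβγ : β * γ < 1) :
    ∃ x₀, 0 < x₀ ∧ γ * x₀ ^ 2 < β ∧ StrictAntiOn (logCriticalActivity β γ) (Set.Ioc 0 x₀) ∧
      StrictMonoOn (logCriticalActivity β γ) (Set.Ici x₀) := by
  have hγ1 : γ ≤ 1 := by nlinarith
  have hc : 0 < 1 - β * γ := by linarith
  -- The derivative of `logCriticalActivity` multiplied by (1 - βγ)x². It is negative at 0 and has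
  -- slope at least 1 - βγ, so it changes sign exactly once.
  set K : ℝ → ℝ := fun x => 2 * (1 - β * γ) * x + (γ * x ^ 2 - β) * logRatio β γ x with hK
  have hKd : ∀ x, 0 ≤ x → HasDerivAt K (2 * (1 - β * γ) + (2 * γ * x * logRatio β γ x +
      (γ * x ^ 2 - β) * ((1 - β * γ) / ((1 + γ * x) * (β + x))))) x := by
    intro x hx
    have d1 := (hasDerivAt_id x).const_mul (2 * (1 - β * γ))
    have d2 := ((hasDerivAt_pow 2 x).const_mul γ).sub_const β
    have d3 := hasDerivAt_logRatio (β := β) (γ := γ) (x := x) (by positivity) (by positivity)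
    refine (d1.add (d2.mul d3)).congr_deriv ?_
    simp only [Nat.cast_ofNat]
    ring
  have hKcont : ContinuousOn K (Set.Ici 0) :=
    fun x hx => (hKd x hx).continuousAt.continuousWithinAt
  have hKd' : ∀ x, 0 ≤ x → 1 - β * γ ≤ deriv K x := by
    intro x hx
    rw [(hKd x hx).deriv]
    have h1 : 0 ≤ 2 * γ * x * logRatio β γ x :=
      mul_nonneg (by positivity) (logRatio_pos hβ hγ0 hγ1 hx).le
    have hP : 0 < (1 + γ * x) * (β + x) := by positivity
    have h2 : -(1 - β * γ) ≤ (γ * x ^ 2 - β) * ((1 - β * γ) / ((1 + γ * x) * (β + x))) := by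
      rw [← mul_div_assoc, le_div_iff₀ hP]
      have : 0 ≤ (γ * x ^ 2 - β) + (1 + γ * x) * (β + x) := by
        have : (γ * x ^ 2 - β) + (1 + γ * x) * (β + x) =
          2 * (γ * x ^ 2) + x + β * (γ * x) := by ring
        rw [this]; positivity
      nlinarith
    linarith
  have hKmono : StrictMonoOn K (Set.Ici 0) := by
    refine strictMonoOn_of_deriv_pos (convex_Ici 0) hKcont fun x hx => ?_
    rw [interior_Ici] at hx
    exact hc.trans_le (hKd' x (le_of_lt hx))
  have hKlin : ∀ x, 0 ≤ x → (1 - β * γ) * x ≤ K x - K 0 := by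
    intro x hx
    have := (convex_Ici (0 : ℝ)).mul_sub_le_image_sub_of_le_deriv hKcont
      (fun x hx => (hKd x (interior_subset hx)).differentiableAt.differentiableWithinAt)
      (fun x hx => hKd' x (interior_subset hx)) 0 Set.self_mem_Ici x hx hx
    simpa using this
  have hK0 : K 0 < 0 := by
    have := logRatio_pos hβ hγ0 hγ1 le_rfl
    simp only [hK]
    nlinarith
  set b := -K 0 / (1 - β * γ) with hb
  have hb0 : 0 ≤ b := div_nonneg (by linarith) hc.le
  have hKb : 0 ≤ K b := by
    have := hKlin b hb0
    rw [hb, mul_div_cancel₀ _ hc.ne'] at this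
    linarith
  obtain ⟨x₀, ⟨hx₀, -⟩, hKx₀⟩ := intermediate_value_Icc hb0
    (hKcont.mono Set.Icc_subset_Ici_self) ⟨hK0.le, hKb⟩
  have hx₀' : 0 < x₀ := by
    rcases hx₀.eq_or_lt with rfl | h
    · exact absurd hKx₀ hK0.ne
    · exact h
  have hder : ∀ x, 0 < x → HasDerivAt (logCriticalActivity β γ)
      (K x / ((1 - β * γ) * x ^ 2)) x := by
    intro x hx
    refine (hasDerivAt_logCriticalActivity hβγ.ne hx.ne' (by positivity)
      (by positivity)).congr_deriv ?_
    rw [abs_of_pos hc, div_self hc.ne']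
    simp only [hK]
    generalize 1 - β * γ = c at hc ⊢
    field_simp
    ring
  refine ⟨x₀, hx₀', ?_, ?_, ?_⟩
  · have h1 := logRatio_pos hβ hγ0 hγ1 hx₀
    have h2 : 0 < 2 * (1 - β * γ) * x₀ := by positivity
    by_contra! h
    have h3 : 0 ≤ (γ * x₀ ^ 2 - β) * logRatio β γ x₀ := mul_nonneg (by linarith) h1.le
    have h4 : 2 * (1 - β * γ) * x₀ + (γ * x₀ ^ 2 - β) * logRatio β γ x₀ = 0 := hKx₀
    linarith
  · refine strictAntiOn_of_deriv_neg (convex_Ioc 0 x₀)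
      (fun x hx => (hder x hx.1).continuousAt.continuousWithinAt) fun x hx => ?_
    rw [interior_Ioc] at hx
    rw [(hder x hx.1).deriv]
    have h0 := hx.1
    exact div_neg_of_neg_of_pos (hKx₀ ▸ hKmono hx.1.le hx₀ hx.2) (by positivity)
  · refine strictMonoOn_of_deriv_pos (convex_Ici x₀)
      (fun x hx => (hder x (hx₀'.trans_le hx)).continuousAt.continuousWithinAt) fun x hx => ?_
    rw [interior_Ici] at hx
    have h0 := hx₀'.trans hx
    rw [(hder x h0).deriv]
    exact div_pos (hKx₀ ▸ hKmono hx₀ h0.le hx) (by positivity)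

/-- For γ > 0, x and β/(γx) are the roots of one quadratic with coefficients depending on the
degree; `hxβ` says that x is the smaller, the one with the minus sign. -/
theorem xHat_criticalDegree (hγ0 : 0 ≤ γ) (hβγ : β * γ < 1) {x : ℝ} (hβ : 0 < β)
    (hx : 0 < x) (hxβ : γ * x ^ 2 < β) : xHat β γ (criticalDegree β γ x) = x := by
  have hc : 0 < 1 - β * γ := by linarith
  rw [criticalDegree, abs_of_pos hc]
  rcases hγ0.eq_or_lt with rfl | hγ
  · rw [xHat, if_pos rfl]
    field_simp
    ring_nf
    field_simp
  · rw [xHat, if_neg hγ.ne']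
    have h1 : -1 - β * γ + (1 + γ * x) * (β + x) / ((1 - β * γ) * x) * (1 - β * γ) =
        γ * x + β / x := by
      field_simp
      ring
    have h2 : (γ * x + β / x) ^ 2 - 4 * (β * γ) = (β / x - γ * x) ^ 2 := by
      field_simp
      ring
    have h3 : 0 ≤ β / x - γ * x := by
      rw [sub_nonneg, le_div_iff₀ hx]
      linarith
    rw [h1, h2, Real.sqrt_sq h3]
    field_simp
    ring

/-- This is the inequality 2√(βγ) x < γx² + β between the means, strict because γx² ≠ β. -/
theorem dBar_lt_criticalDegree (hβ : 0 < β) (hγ0 : 0 ≤ γ) (hβγ : β * γ < 1) {x : ℝ}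
    (hx : 0 < x) (hxβ : γ * x ^ 2 < β) : dBar β γ < criticalDegree β γ x := by
  have hc : 0 < 1 - β * γ := by linarith
  rw [criticalDegree, abs_of_pos hc, dBar]
  set a := √(β * γ) with ha
  have ha0 : 0 ≤ a := Real.sqrt_nonneg _
  have ha2 : a ^ 2 = β * γ := Real.sq_sqrt (by positivity)
  have ha1 : a < 1 := by nlinarith
  have h1 : 2 * a * x < γ * x ^ 2 + β := by
    refine lt_of_pow_lt_pow_left₀ 2 (by positivity) ?_
    have : 0 < (β - γ * x ^ 2) ^ 2 := by
      have : 0 < β - γ * x ^ 2 := by linarith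
      positivity
    calc (2 * a * x) ^ 2 = 4 * (β * γ) * x ^ 2 := by rw [← ha2]; ring
      _ < _ := by linarith
  have ha1' : 0 < 1 - a := by linarith
  rw [← ha2, div_lt_div_iff₀ ha1' (by rw [ha2]; positivity)]
  have h2 : (1 + a) ^ 2 * x < (1 + γ * x) * (β + x) := by
    calc (1 + a) ^ 2 * x = x + β * γ * x + 2 * a * x := by rw [← ha2]; ring
      _ < x + β * γ * x + (γ * x ^ 2 + β) := by linarith
      _ = _ := by ring
  calc (1 + a) * ((1 - a ^ 2) * x) = (1 + a) ^ 2 * x * (1 - a) := by ring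
    _ < _ := by gcongr

theorem xHat_spec (hβ : 0 < β) (hγ0 : 0 ≤ γ) (hβγ : β * γ < 1) {d : ℝ} (hd : dBar β γ < d) :
    0 < xHat β γ d ∧ γ * xHat β γ d ^ 2 < β ∧ criticalDegree β γ (xHat β γ d) = d := by
  have hc : 0 < 1 - β * γ := by linarith
  rcases hγ0.eq_or_lt with rfl | hγ
  · have hd1 : 0 < d - 1 := by simp [dBar] at hd; linarith
    have hx : xHat β 0 d = β / (d - 1) := if_pos rfl
    refine ⟨by rw [hx]; positivity, by simpa using hβ, ?_⟩
    rw [hx, criticalDegree]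
    simp only [mul_zero, zero_mul, add_zero, sub_zero, abs_one, one_mul]
    field_simp
    ring
  · have hx : xHat β γ d = _ := if_neg hγ.ne'
    set c := -1 - β * γ + d * (1 - β * γ) with hcdef
    have hc2 : 2 * √(β * γ) < c := by
      rw [dBar] at hd
      set a := √(β * γ) with ha
      have ha0 : 0 ≤ a := Real.sqrt_nonneg _
      have ha2 : a ^ 2 = β * γ := Real.sq_sqrt (by positivity)
      have ha1 : a < 1 := by nlinarith
      rw [div_lt_iff₀ (by linarith)] at hd
      rw [hcdef, ← ha2]
      nlinarith
    have hcpos : 0 < c := lt_of_le_of_lt (by positivity) hc2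
    have hD : 0 < c ^ 2 - 4 * (β * γ) := by
      have h := pow_lt_pow_left₀ hc2 (by positivity) two_ne_zero
      rw [mul_pow, Real.sq_sqrt (by positivity)] at h
      linarith
    set r := √(c ^ 2 - 4 * (β * γ)) with hr
    have hr0 : 0 < r := Real.sqrt_pos.2 hD
    have hr2 : r ^ 2 = c ^ 2 - 4 * (β * γ) := Real.sq_sqrt hD.le
    have hrc : r < c := by
      refine lt_of_pow_lt_pow_left₀ 2 hcpos.le ?_
      rw [hr2]
      have : 0 < β * γ := by positivity
      linarith
    have hxpos : 0 < xHat β γ d := by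
      rw [hx]
      exact div_pos (by linarith) (by positivity)
    have hxr : 2 * γ * xHat β γ d = c - r := by
      rw [hx]; field_simp
    generalize xHat β γ d = x at hxpos hxr
    have hquad : γ * x ^ 2 - c * x + β = 0 := by
      have : 4 * γ * (γ * x ^ 2 - c * x + β) = 0 := by
        have h : (2 * γ * x - c) ^ 2 = c ^ 2 - 4 * (β * γ) := by rw [hxr, ← hr2]; ring
        linarith
      rcases mul_eq_zero.1 this with h | h
      · linarith
      · exact h
    refine ⟨hxpos, ?_, ?_⟩
    · have : 2 * γ * x * x < c * x := by
        rw [hxr]; nlinarith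
      nlinarith
    · rw [criticalDegree, abs_of_pos hc, div_eq_iff (by positivity)]
      rw [hcdef] at hquad
      linarith

theorem criticalDegree_le_of_le (hβγ : β * γ < 1) {x y : ℝ} (hγ0 : 0 ≤ γ) (hx : 0 < x)
    (hxy : x ≤ y) (hyβ : γ * y ^ 2 < β) : criticalDegree β γ y ≤ criticalDegree β γ x := by
  have hc : 0 < 1 - β * γ := by linarith
  have hy : 0 < y := hx.trans_le hxy
  rw [criticalDegree, criticalDegree, abs_of_pos hc,
    div_le_div_iff₀ (by positivity) (by positivity)]
  have h1 : γ * x * y ≤ β := by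
    have : γ * x * y ≤ γ * y * y := by gcongr
    linarith
  have h2 : 0 ≤ (1 - β * γ) * ((y - x) * (β - γ * x * y)) :=
    mul_nonneg hc.le (mul_nonneg (by linarith) (by linarith))
  linarith

theorem xHat_lt_of_lt (hβ : 0 < β) (hγ0 : 0 ≤ γ) (hβγ : β * γ < 1) {d d' : ℝ}
    (hd : dBar β γ < d) (hdd' : d < d') : xHat β γ d' < xHat β γ d := by
  obtain ⟨h1, -, h3⟩ := xHat_spec hβ hγ0 hβγ hd
  obtain ⟨-, h2', h3'⟩ := xHat_spec hβ hγ0 hβγ (hd.trans hdd')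
  by_contra! h
  have := criticalDegree_le_of_le hβγ hγ0 h1 h h2'
  linarith

/-- Transfers monotonicity from x to d. As `xHat` decreases, the two monotone branches are
interchanged. -/
theorem lamC_eq_exp (hβ : 0 < β) (hγ0 : 0 ≤ γ) (hβγ : β * γ < 1) {d : ℝ} (hd : dBar β γ < d) :
    lamC β γ d = Real.exp (logCriticalActivity β γ (xHat β γ d)) := by
  obtain ⟨h1, -, h3⟩ := xHat_spec hβ hγ0 hβγ hd
  rw [logCriticalActivity, h3, lamC, Real.exp_add, Real.exp_log h1, logRatio,
    ← Real.log_div (by positivity) (by positivity), Real.rpow_def_of_pos (by positivity),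
    add_comm (xHat β γ d) β, add_comm (γ * xHat β γ d) 1, mul_comm d]

/-- The antiferromagnetic critical activity. -/
theorem lamC_dC_le_exp (hβ : 1 < β) (hγ0 : 0 ≤ γ) (hβγ : β * γ < 1) {x : ℝ} (hx : 0 < x) :
    lamC β γ (dC β γ) ≤ Real.exp (logCriticalActivity β γ x) := by
  have hβ0 : 0 < β := by linarith
  obtain ⟨x₀, hx₀, hx₀β, hanti, hmono⟩ := exists_turningPoint_logCriticalActivity hβ hγ0 hβγ
  have hd := dBar_lt_criticalDegree hβ0 hγ0 hβγ hx₀ hx₀β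
  have hxd := xHat_criticalDegree hγ0 hβγ hβ0 hx₀ hx₀β
  have htp : IsTurningPoint β γ (criticalDegree β γ x₀) := by
    refine ⟨hd, fun d hd1 d' hd2 hdd' => ?_, fun d hd1 d' hd2 hdd' => ?_⟩
    · rw [lamC_eq_exp hβ0 hγ0 hβγ hd1.1, lamC_eq_exp hβ0 hγ0 hβγ hd2.1]
      have h1 := xHat_lt_of_lt hβ0 hγ0 hβγ hd1.1 hdd'
      have h2 := xHat_lt_of_lt hβ0 hγ0 hβγ hd2.1 hd2.2
      rw [hxd] at h2
      exact Real.exp_lt_exp.2 (hmono h2.le (h2.trans h1).le h1)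
    · rw [lamC_eq_exp hβ0 hγ0 hβγ (hd.trans hd1), lamC_eq_exp hβ0 hγ0 hβγ (hd.trans hd2)]
      have h1 := xHat_lt_of_lt hβ0 hγ0 hβγ (hd.trans hd1) hdd'
      have h2 := xHat_lt_of_lt hβ0 hγ0 hβγ hd hd1
      rw [hxd] at h2
      have h3 := (xHat_spec hβ0 hγ0 hβγ (hd.trans hd2)).1
      exact Real.exp_lt_exp.2 (hanti ⟨h3, (h1.trans h2).le⟩ ⟨h3.trans h1, h2.le⟩ h1)
  -- The choice in `dC` is meaningful only once a turning point exists; uniqueness then identifies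
  -- it.
  have hdC : dC β γ = criticalDegree β γ x₀ :=
    (Classical.epsilon_spec (p := IsTurningPoint β γ) ⟨_, htp⟩).unique htp
  rw [hdC, lamC_eq_exp hβ0 hγ0 hβγ hd, hxd]
  refine Real.exp_le_exp.2 ?_
  rcases le_total x x₀ with h | h
  · exact hanti.antitoneOn ⟨hx, h⟩ ⟨hx₀, le_rfl⟩ h
  · exact hmono.monotoneOn Set.self_mem_Ici h h

end TurningPoint

end TwoSpin

theorem mainTheorem3 (β γ lam₀ : ℝ) (hβ : 0 < β) (hγ : 0 ≤ γ) (hlam₀ : lam₀ ≠ 0)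
    (hcond :
      (1 < β * γ ∧ γ ≤ 1 ∧ -1 < lam₀ ∧
        lam₀ < (β / γ) ^ (√(β * γ) / (√(β * γ) - 1))) ∨
      (β * γ < 1 ∧ 1 < β ∧ max (-1) (-((β - 1) / (1 - γ))) < lam₀ ∧
        lam₀ < TwoSpin.lamC β γ (TwoSpin.dC β γ))) :
    ∃ δ : ℝ, 0 < δ ∧
      ∀ lam : ℂ, lam ∈ Metric.thickening δ (segment ℝ (0 : ℂ) (lam₀ : ℂ)) → lam ≠ 0 →
        ∀ (V : Type*) [Fintype V] (G : SimpleGraph V) (S : Set V) (τ : S → Fin 2),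
          TwoSpin.Feasible β γ G S τ →
            TwoSpin.partitionFunction β γ G S τ lam ≠ 0 := by
  rcases hcond with ⟨hβγ, hγ1, h1, h2⟩ | ⟨hβγ, hβ1, h1, h2⟩
  · have hβ1 : 1 < β := by nlinarith
    refine TwoSpin.exists_zeroFree_of_contraction hβ1.le hγ hγ1 h1 ?_
    rcases hlam₀.lt_or_gt with hl | hl
    · exact TwoSpin.contraction_of_neg hβ1 hγ hγ1 h1 hl fun h => absurd h hβγ.not_ge
    · exact TwoSpin.contraction_of_pos hβ1 hγ hγ1 hβγ.ne' hl fun x hx =>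
        TwoSpin.log_lt_logCriticalActivity_of_one_lt hβ hγ1 hβγ hl h2 hx
  · have hγ1 : γ < 1 := by nlinarith
    have hl1 := (le_max_left _ _).trans_lt h1
    have hl2 := (le_max_right _ _).trans_lt h1
    refine TwoSpin.exists_zeroFree_of_contraction hβ1.le hγ hγ1.le hl1 ?_
    rcases hlam₀.lt_or_gt with hl | hl
    · refine TwoSpin.contraction_of_neg hβ1 hγ hγ1.le hl1 hl fun _ => ?_
      rw [neg_lt, lt_div_iff₀ (by linarith)] at hl2
      linarith
    · exact TwoSpin.contraction_of_pos hβ1 hγ hγ1.le hβγ.ne hl fun x hx =>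
        (Real.log_lt_iff_lt_exp hl).2 (h2.trans_le (TwoSpin.lamC_dC_le_exp hβ1 hγ hβγ hx))
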